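/- Let $n\geq 2$ and let $(M^{2n},g,J)$ be a Kaehler manifold of real dimension $2n$, that is, a smooth manifold with a smooth Riemannian metric $g$ and a smooth field $J$ of endomorphisms of the tangent spaces such that $J^2=-I$, $g(JX,JY)=g(X,Y)$ for all tangent vectors $X,Y$ at the same point, and $\nabla J=0$ for the Levi-Civita connection $\nabla$ of $g$. Suppose that there is a point $p\in M^{2n}$ at which all holomorphic sectional curvatures are positive, that is, the sectional curvature satisfies $K(X,JX)>0$ for every $0\neq X\in T_pM$. Then there is no (smooth) isometric immersion of $M^{2n}$ into the hyperbolic space $\mathbb{H}^{3n-1}$ of constant sectional curvature $-1$. -/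

import Mathlib

open scoped Manifold ContDiff

noncomputable section

/-! ### Riemannian metrics and endomorphism fields on a smooth manifold -/

section Riemannian

/-- Smooth Riemannian metrics on the `d`-dimensional smooth manifold `M`. -/
abbrev SmoothMetric (d : ℕ) (M : Type*) [TopologicalSpace M]
    [ChartedSpace (EuclideanSpace ℝ (Fin d)) M] [IsManifold (𝓡 d) ∞ M] : Type _ :=
  Bundle.ContMDiffRiemannianMetric (𝓡 d) ∞ (EuclideanSpace ℝ (Fin d))
    (fun x : M => TangentSpace (𝓡 d) x)

/-- Smooth fields of endomorphisms of the tangent spaces, that is, smooth `(1,1)`-tensor fields. -/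
abbrev SmoothEndField (d : ℕ) (M : Type*) [TopologicalSpace M]
    [ChartedSpace (EuclideanSpace ℝ (Fin d)) M] [IsManifold (𝓡 d) ∞ M] : Type _ :=
  ContMDiffSection (𝓡 d) (EuclideanSpace ℝ (Fin d) →L[ℝ] EuclideanSpace ℝ (Fin d)) ∞
    (fun x : M => TangentSpace (𝓡 d) x →L[ℝ] TangentSpace (𝓡 d) x)

/-- The partial derivative `∂_i h` of a real function on `ℝ^d`. -/
def coordDeriv {d : ℕ} (i : Fin d) (h : EuclideanSpace ℝ (Fin d) → ℝ)
    (u : EuclideanSpace ℝ (Fin d)) : ℝ :=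
  fderiv ℝ h u (EuclideanSpace.single i 1)

variable {d : ℕ} {M : Type*} [TopologicalSpace M] [ChartedSpace (EuclideanSpace ℝ (Fin d)) M]

/-- The coordinate vector `∂_i` of the chart at `x₀`, at the point with coordinates `u`. -/
def coordVec (x₀ : M) (i : Fin d) (u : EuclideanSpace ℝ (Fin d)) :
    TangentSpace (𝓡 d) ((extChartAt (𝓡 d) x₀).symm u) :=
  mfderiv 𝓘(ℝ, EuclideanSpace ℝ (Fin d)) (𝓡 d) (extChartAt (𝓡 d) x₀).symm u
    (EuclideanSpace.single i (1 : ℝ) : EuclideanSpace ℝ (Fin d))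

/-- The components `X^i` of a tangent vector `X = ∑ X^i ∂_i` in the chart at `x₀`. -/
def coordComp (x₀ : M) {x : M} (X : TangentSpace (𝓡 d) x) : EuclideanSpace ℝ (Fin d) :=
  mfderiv (𝓡 d) 𝓘(ℝ, EuclideanSpace ℝ (Fin d)) (extChartAt (𝓡 d) x₀) x X

variable [IsManifold (𝓡 d) ∞ M]

/-- The components `g_{ij} = g(∂_i, ∂_j)` of the metric in the chart at `x₀`. -/
def metricCoeff (g : SmoothMetric d M) (x₀ : M) (u : EuclideanSpace ℝ (Fin d)) :
    Matrix (Fin d) (Fin d) ℝ :=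
  Matrix.of fun i j =>
    g.inner ((extChartAt (𝓡 d) x₀).symm u) (coordVec x₀ i u) (coordVec x₀ j u)

/-- The Christoffel symbols of the Levi-Civita connection in the chart at `x₀`,
`Γ^k_{ij} = ½ ∑_l g^{kl} (∂_i g_{jl} + ∂_j g_{il} - ∂_l g_{ij})`, so `∇_{∂_i} ∂_j = Γ^k_{ij} ∂_k`. -/
def christoffel (g : SmoothMetric d M) (x₀ : M) (k i j : Fin d)
    (u : EuclideanSpace ℝ (Fin d)) : ℝ :=
  (1 / 2) * ∑ l, (metricCoeff g x₀ u)⁻¹ k l *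
    (coordDeriv i (fun v => metricCoeff g x₀ v j l) u
      + coordDeriv j (fun v => metricCoeff g x₀ v i l) u
      - coordDeriv l (fun v => metricCoeff g x₀ v i j) u)

/-- The components of the curvature tensor `R(X,Y)Z = ∇_X ∇_Y Z - ∇_Y ∇_X Z - ∇_{[X,Y]} Z` in the
chart at `x₀`: `R(∂_i, ∂_j) ∂_k = ∑_l (curvCoeff g x₀ l k i j) ∂_l`. -/
def curvCoeff (g : SmoothMetric d M) (x₀ : M) (l k i j : Fin d)
    (u : EuclideanSpace ℝ (Fin d)) : ℝ :=
  coordDeriv i (christoffel g x₀ l j k) u - coordDeriv j (christoffel g x₀ l i k) u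
    + ∑ m, (christoffel g x₀ l i m u * christoffel g x₀ m j k u
      - christoffel g x₀ l j m u * christoffel g x₀ m i k u)

/-- `⟨R(X,Y)Z, W⟩` at the point `p`, computed in the chart at `p`. -/
def riemannTensor (g : SmoothMetric d M) (p : M) (X Y Z W : TangentSpace (𝓡 d) p) : ℝ :=
  ∑ i, ∑ j, ∑ k, ∑ l, ∑ m,
    metricCoeff g p (extChartAt (𝓡 d) p p) l m
      * curvCoeff g p l k i j (extChartAt (𝓡 d) p p)
      * coordComp p X i * coordComp p Y j * coordComp p Z k * coordComp p W m

/-- The sectional curvature `K(X,Y) = ⟨R(X,Y)Y, X⟩ / (|X|²|Y|² - ⟨X,Y⟩²)` at `p` of the plane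
spanned by the linearly independent vectors `X` and `Y`. -/
def sectionalCurvature (g : SmoothMetric d M) (p : M) (X Y : TangentSpace (𝓡 d) p) : ℝ :=
  riemannTensor g p X Y Y X / (g.inner p X X * g.inner p Y Y - g.inner p X Y ^ 2)

/-- The components of an endomorphism field in the chart at `x₀`: `J ∂_j = ∑_k J^k_j ∂_k`. -/
def endCoeff (J : SmoothEndField d M) (x₀ : M) (k j : Fin d)
    (u : EuclideanSpace ℝ (Fin d)) : ℝ :=
  coordComp x₀ (J ((extChartAt (𝓡 d) x₀).symm u) (coordVec x₀ j u)) k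

/-- The components `(∇_i J)^k_j` of the covariant derivative of `J` in the chart at `x₀`. -/
def covDerivEnd (g : SmoothMetric d M) (J : SmoothEndField d M) (x₀ : M) (k i j : Fin d)
    (u : EuclideanSpace ℝ (Fin d)) : ℝ :=
  coordDeriv i (endCoeff J x₀ k j) u
    + ∑ m, (christoffel g x₀ k i m u * endCoeff J x₀ m j u
      - christoffel g x₀ m i j u * endCoeff J x₀ k m u)

/-- `(M, g, J)` is a Kaehler manifold: `J` is an almost complex structure that is orthogonal and
parallel with respect to the Levi-Civita connection of `g`. -/
structure IsKaehler (g : SmoothMetric d M) (J : SmoothEndField d M) : Prop where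
  sq_eq_neg : ∀ (x : M) (X : TangentSpace (𝓡 d) x), J x (J x X) = -X
  orthogonal : ∀ (x : M) (X Y : TangentSpace (𝓡 d) x),
    g.inner x (J x X) (J x Y) = g.inner x X Y
  parallel : ∀ (x₀ : M), ∀ u ∈ (extChartAt (𝓡 d) x₀).target, ∀ k i j : Fin d,
    covDerivEnd g J x₀ k i j u = 0

/-- All holomorphic sectional curvatures `K(X, JX)`, `0 ≠ X ∈ T_pM`, are positive. -/
def HasPosHolSecCurvAt (g : SmoothMetric d M) (J : SmoothEndField d M) (p : M) : Prop :=
  ∀ X : TangentSpace (𝓡 d) p, X ≠ 0 → 0 < sectionalCurvature g p X (J p X)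

end Riemannian

/-! ### Hyperbolic space -/

/-- The vector space `ℝ × ℝ^m` underlying the `(m+1)`-dimensional Lorentzian space; the first
coordinate is the time-like one. -/
abbrev LorentzSpace (m : ℕ) : Type := ℝ × EuclideanSpace ℝ (Fin m)

/-- The Lorentzian inner product. -/
def lorentzInner {m : ℕ} (v w : LorentzSpace m) : ℝ :=
  -(v.1 * w.1) + inner ℝ v.2 w.2

/-- Hyperbolic space `ℍ^m` of constant sectional curvature `-1`: the upper sheet of the hyperboloid
`⟨v,v⟩ = -1` in Lorentzian space, an embedded submanifold with the induced metric. -/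
def HyperbolicSpace (m : ℕ) : Set (LorentzSpace m) :=
  {v | lorentzInner v v = -1 ∧ 0 < v.1}

/-- Isometric immersions of `(M, g)` into `ℍ^m`. As `ℍ^m` is an embedded submanifold of Lorentzian
space with the induced metric, smoothness and the differential are those of the composition with
the inclusion; injectivity of the differential follows from `isometric`. -/
structure IsIsometricImmersion {d : ℕ} {M : Type*} [TopologicalSpace M]
    [ChartedSpace (EuclideanSpace ℝ (Fin d)) M] [IsManifold (𝓡 d) ∞ M]
    (g : SmoothMetric d M) {m : ℕ} (f : M → HyperbolicSpace m) : Prop where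
  smooth : ContMDiff (𝓡 d) 𝓘(ℝ, LorentzSpace m) ∞ (fun x => (f x : LorentzSpace m))
  isometric : ∀ (x : M) (X Y : TangentSpace (𝓡 d) x),
    lorentzInner
        (mfderiv (𝓡 d) 𝓘(ℝ, LorentzSpace m) (fun y => (f y : LorentzSpace m)) x X : LorentzSpace m)
        (mfderiv (𝓡 d) 𝓘(ℝ, LorentzSpace m) (fun y => (f y : LorentzSpace m)) x Y : LorentzSpace m)
      = g.inner x X Y

end

/-!
Let `f : M → ℍ^m` be an isometric immersion of a Kaehler manifold of complex dimension `n`, with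
`m + 1 ≤ 3n`, and regard it as a map to Lorentzian space; let `α` be its second fundamental form
there, with values in the normal space `N` of dimension `m + 1 - 2n ≤ n`. As `R(X, Y)` commutes with
`J`, the Gauss equation makes the `J`-invariant part `H(X, Y) = α(X, Y) + α(JX, JY)` the real part
of a hermitian form `B` with values in the complexification of `N` that is flat,
`⟨B(Y, X), B(W, Z)⟩ = ⟨B(W, X), B(Y, Z)⟩`.

Suppose that all holomorphic sectional curvatures are positive at a point. The components of
`α(X, JX)` and `α(X, X) - α(JX, JX)` along the position vector vanish, so these vectors are
space-like, and `⟨H(X, X), H(X, X)⟩ ≥ 4⟨R(X, JX)JX, X⟩ > 0` for `X ≠ 0`. Hence `B(Z, ·)` is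
injective for a generic `Z`, and an isomorphism by the bound on `dim N`. Flatness then says that
the endomorphisms `B(W, ·) ∘ B(Z, ·)⁻¹` commute and are symmetric. They have common eigenvectors of
the form `B(Y, Y) = H(Y, Y)`, which are real and space-like, and splitting these off one after
another shows that the scalar product of `N` is nonnegative. But `N` contains the time-like position
vector.
-/

/-! ### Flat hermitian forms -/

section FlatHermitian

open Module

theorem exists_common_eigenvector {κ K L : Type*} [Field K] [IsAlgClosed K] [AddCommGroup L]
    [Module K L] [FiniteDimensional K L] {D : κ → End K L} (hD : ∀ i j, Commute (D i) (D j))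
    {T : Submodule K L} (hT : T ≠ ⊥) (hinv : ∀ i, T ∈ (D i).invtSubmodule) :
    ∃ ξ ∈ T, ξ ≠ 0 ∧ ∀ i, ∃ c : K, D i ξ = c • ξ := by
  induction T using WellFoundedLT.induction with
  | _ T ih =>
    by_cases hscalar : ∀ i, ∃ c : K, ∀ x ∈ T, D i x = c • x
    · obtain ⟨ξ, hξT, hξ⟩ := T.exists_mem_ne_zero_of_ne_bot hT
      exact ⟨ξ, hξT, hξ, fun i => (hscalar i).imp fun c hc => hc ξ hξT⟩
    push Not at hscalar
    obtain ⟨i, hi⟩ := hscalar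
    have : Nontrivial T := Submodule.nontrivial_iff_ne_bot.mpr hT
    obtain ⟨c, hc⟩ := End.exists_eigenvalue ((D i).restrict (hinv i))
    obtain ⟨⟨v, hvT⟩, hv⟩ := hc.exists_hasEigenvector
    have hv_mem : v ∈ (D i).eigenspace c :=
      End.mem_eigenspace_iff.mpr (congrArg Subtype.val hv.apply_eq_smul)
    have hlt : T ⊓ (D i).eigenspace c < T := by
      refine inf_le_left.lt_of_ne fun heq => ?_
      obtain ⟨x, hx, hne⟩ := hi c
      rw [← heq] at hx
      exact hne (End.mem_eigenspace_iff.mp hx.2)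
    obtain ⟨ξ, hξ, h⟩ := ih _ hlt
      ((Submodule.ne_bot_iff _).mpr ⟨v, ⟨hvT, hv_mem⟩, fun h0 => hv.2 (Subtype.ext h0)⟩)
      fun j => Sublattice.inf_mem (hinv j) (End.mapsTo_genEigenspace_of_comm (hD i j) c 1)
    exact ⟨ξ, hξ.1, h⟩

theorem exists_finrank_range_lt_finrank_range_add_smul {𝕜 V L : Type*} [NontriviallyNormedField 𝕜]
    [CompleteSpace 𝕜] [AddCommGroup V] [Module 𝕜 V] [NormedAddCommGroup L] [NormedSpace 𝕜 L]
    [FiniteDimensional 𝕜 L] {f g : V →ₗ[𝕜] L} {u : V} (hfu : f u = 0)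
    (hgu : g u ∉ LinearMap.range f) :
    ∃ t : 𝕜, finrank 𝕜 (LinearMap.range f) < finrank 𝕜 (LinearMap.range (f + t • g)) := by
  let b := finBasis 𝕜 (LinearMap.range f)
  choose y hy using fun i => (b i).2
  let c (t : 𝕜) : Fin (finrank 𝕜 (LinearMap.range f) + 1) → L :=
    Fin.cons (g u) fun i => (f + t • g) (y i)
  have hc_cont : Continuous c := continuous_pi <| Fin.cases continuous_const fun i => by
    simp only [c, Fin.cons_succ, LinearMap.add_apply, LinearMap.smul_apply]
    fun_prop
  have hc_zero : LinearIndependent 𝕜 (c 0) := by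
    have htail : (fun i => (f + (0 : 𝕜) • g) (y i)) = (LinearMap.range f).subtype ∘ b := by
      ext i
      simp [hy]
    simp only [c, htail]
    refine linearIndependent_finCons.mpr ⟨b.linearIndependent.map' _ (Submodule.ker_subtype _),
      fun h => hgu (Submodule.span_le.mpr ?_ h)⟩
    rintro _ ⟨i, rfl⟩
    exact (b i).2
  have hev : ∀ᶠ t in nhdsWithin (0 : 𝕜) {0}ᶜ, LinearIndependent 𝕜 (c t) :=
    (hc_cont.continuousAt.eventually
      (isOpen_setOfPred_linearIndependent.mem_nhds hc_zero)).filter_mono nhdsWithin_le_nhds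
  obtain ⟨t, hct, ht : t ≠ 0⟩ := (hev.and self_mem_nhdsWithin).exists
  have hc_mem : ∀ i, c t i ∈ LinearMap.range (f + t • g) :=
    Fin.cases ⟨t⁻¹ • u, by simp [c, hfu, smul_smul, ht]⟩ fun i => ⟨y i, rfl⟩
  have hrestrict : LinearIndependent 𝕜
      (fun i => ⟨c t i, hc_mem i⟩ : _ → LinearMap.range (f + t • g)) :=
    .of_comp (Submodule.subtype _) hct
  exact ⟨t, by simpa using hrestrict.fintype_card_le_finrank⟩

section Flat

variable {𝕜 V L : Type*} [NontriviallyNormedField 𝕜] [CompleteSpace 𝕜] [AddCommGroup V] [Module 𝕜 V]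
  [NormedAddCommGroup L] [NormedSpace 𝕜 L] [FiniteDimensional 𝕜 L] {σ : 𝕜 →+* 𝕜}
  [RingHomSurjective σ]

theorem exists_forall_map_ker_le_range {W : Type*} [AddCommGroup W] [Module 𝕜 W]
    (B : W →ₛₗ[σ] V →ₗ[𝕜] L) :
    ∃ z, ∀ w, (LinearMap.ker (B z)).map (B w) ≤ LinearMap.range (B z) := by
  have hbdd : BddAbove (Set.range fun w => finrank 𝕜 (LinearMap.range (B w))) :=
    ⟨finrank 𝕜 L, Set.forall_mem_range.mpr fun _ => Submodule.finrank_le _⟩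
  -- We take `z` with `B z` of maximal rank: a vector `B w u` with `u` in the kernel of `B z` that
  -- is outside the range of `B z` would make the rank of `B (z + s • w)` larger for small `s`.
  obtain ⟨z, hz⟩ := Nat.sSup_mem (Set.range_nonempty _) hbdd
  refine ⟨z, fun w => ?_⟩
  rintro _ ⟨u, hu, rfl⟩
  by_contra hwu
  obtain ⟨t, ht⟩ := exists_finrank_range_lt_finrank_range_add_smul hu hwu
  obtain ⟨s, rfl⟩ := σ.surjective t
  rw [← LinearMap.map_smulₛₗ, ← map_add] at ht
  exact ht.not_ge (hz.ge.trans' (le_csSup hbdd ⟨_, rfl⟩))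

theorem exists_injective_of_flat {β : LinearMap.BilinForm 𝕜 L} {B : V →ₛₗ[σ] V →ₗ[𝕜] L}
    (hflat : ∀ X Y Z W, β (B Y X) (B W Z) = β (B W X) (B Y Z))
    (hdiag : ∀ X, X ≠ 0 → β (B X X) (B X X) ≠ 0) : ∃ Z, Function.Injective (B Z) := by
  obtain ⟨Z, hZ⟩ := exists_forall_map_ker_le_range B
  refine ⟨Z, (injective_iff_map_eq_zero _).mpr fun U hU => ?_⟩
  by_contra hU0
  obtain ⟨Y, hY⟩ := hZ U ⟨U, hU, rfl⟩
  have hU_self : β (B U U) (B U U) = 0 := calc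
    β (B U U) (B U U) = β (B U U) (B Z Y) := by rw [hY]
    _ = β (B Z U) (B U Y) := hflat _ _ _ _
    _ = 0 := by rw [hU, map_zero, LinearMap.zero_apply]
  exact hdiag U hU0 hU_self

end Flat

section RealVectors

variable {L : Type*} [AddCommGroup L] [Module ℂ L] [StarAddMonoid L]
  {β : LinearMap.BilinForm ℂ L}

theorem ofReal_re_apply_of_star_eq (hstar : ∀ x y, β (star x) (star y) = star (β x y)) {x y : L}
    (hx : star x = x) (hy : star y = y) : ((β x y).re : ℂ) = β x y :=
  Complex.conj_eq_iff_re.mp <| by rw [starRingEnd_apply, ← hstar, hx, hy]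

theorem re_apply_self_nonneg_of_exists_eigenvector [FiniteDimensional ℂ L] [StarModule ℂ L]
    (hβ : β.IsSymm) (hstar : ∀ x y, β (star x) (star y) = star (β x y)) {κ : Type*}
    {D : κ → End ℂ L} (hD : ∀ i, β.IsSelfAdjoint (D i))
    (hex : ∀ T : Submodule ℂ L, T ≠ ⊥ → (∀ i, T ∈ (D i).invtSubmodule) →
      ∃ η ∈ T, star η = η ∧ 0 < (β η η).re ∧ ∀ i, ∃ c : ℂ, D i η = c • η)
    {T : Submodule ℂ L} (hinv : ∀ i, T ∈ (D i).invtSubmodule) {v : L} (hvT : v ∈ T)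
    (hv : star v = v) : 0 ≤ (β v v).re := by
  induction T using WellFoundedLT.induction generalizing v with
  | _ T ih =>
    obtain rfl | hT := eq_or_ne T ⊥
    · simp [(Submodule.mem_bot ℂ).mp hvT]
    obtain ⟨η, hηT, hη, hpos, heig⟩ := hex T hT hinv
    set q := (β η η).re with hq
    set r := (β η v).re with hr
    have hβη : β η η = q := (ofReal_re_apply_of_star_eq hstar hη hη).symm
    have hβηv : β η v = r := (ofReal_re_apply_of_star_eq hstar hη hv).symm
    have hq0 : (q : ℂ) ≠ 0 := mod_cast hpos.ne'
    have hlt : T ⊓ LinearMap.ker (β η) < T := by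
      refine inf_le_left.lt_of_ne fun heq => hq0 ?_
      rw [← heq] at hηT
      exact hβη.symm.trans hηT.2
    have hker_inv : ∀ i, LinearMap.ker (β η) ∈ (D i).invtSubmodule := fun i x hx => by
      obtain ⟨c, hc⟩ := heig i
      have hadj : β (D i η) x = β η (D i x) := hD i η x
      rw [Submodule.mem_comap, LinearMap.mem_ker, ← hadj, hc, map_smul, LinearMap.smul_apply,
        LinearMap.mem_ker.mp hx, smul_zero]
    -- Subtracting from `v` its projection to `η` lands in a smaller invariant subspace and lowers
    -- `β v v` by `r ^ 2 / q ≥ 0`.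
    let w := v - ((r / q : ℝ) : ℂ) • η
    have hw_mem : w ∈ T ⊓ LinearMap.ker (β η) := by
      refine ⟨T.sub_mem hvT (T.smul_mem _ hηT), ?_⟩
      simp [w, hβη, hβηv, hq0]
    have hw_star : star w = w := by simp [w, hv, hη]
    have hw_self : β w w = β v v - ((r ^ 2 / q : ℝ) : ℂ) := by
      simp only [w, map_sub, map_smul, LinearMap.sub_apply, LinearMap.smul_apply, hβη, hβηv,
        hβ.eq v η, smul_eq_mul]
      push_cast
      field_simp
      ring
    have hw : 0 ≤ (β w w).re :=
      ih _ hlt (fun i => Sublattice.inf_mem (hinv i) (hker_inv i)) hw_mem hw_star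
    rw [hw_self, Complex.sub_re, Complex.ofReal_re] at hw
    have : 0 ≤ r ^ 2 / q := by positivity
    linarith

end RealVectors

section Hermitian

variable {L : Type*} [NormedAddCommGroup L] [NormedSpace ℂ L] [FiniteDimensional ℂ L]
  [StarAddMonoid L] [StarModule ℂ L] {β : LinearMap.BilinForm ℂ L}
  {V : Type*} [AddCommGroup V] [Module ℂ V] {B : V →ₗ⋆[ℂ] V →ₗ[ℂ] L}

theorem re_apply_self_nonneg_of_flat_hermitian (hβ : β.IsSymm) (hnd : β.Nondegenerate)
    (hstar : ∀ x y, β (star x) (star y) = star (β x y)) (hdim : finrank ℂ L ≤ finrank ℂ V)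
    (hherm : ∀ X Y, star (B X Y) = B Y X)
    (hflat : ∀ X Y Z W, β (B Y X) (B W Z) = β (B W X) (B Y Z))
    (hpos : ∀ X, X ≠ 0 → 0 < (β (B X X) (B X X)).re) {v : L} (hv : star v = v) :
    0 ≤ (β v v).re := by
  obtain ⟨Z, hZ⟩ := exists_injective_of_flat hflat fun X hX h =>
    (hpos X hX).ne' (by rw [h, Complex.zero_re])
  let e : V ≃ₗ[ℂ] L :=
    .ofInjectiveOfFinrankEq (B Z) hZ
      (le_antisymm (LinearMap.finrank_le_finrank_of_injective hZ) hdim)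
  let D (W : V) : End ℂ L := B W ∘ₗ e.symm.toLinearMap
  have hDe : ∀ W Y, D W (e Y) = B W Y := fun W Y => by simp [D]
  have hself : ∀ W, β.IsSelfAdjoint (D W) := fun W => e.surjective.forall₂.mpr fun X Y => by
    rw [hDe, hDe]
    exact (hflat X Z Y W).symm
  have hcomm : ∀ W X, Commute (D W) (D X) := fun W X => LinearMap.ext fun x => by
    refine sub_eq_zero.mp (hnd.1 _ (e.surjective.forall.mpr fun Y => ?_))
    obtain ⟨X', rfl⟩ := e.surjective x
    rw [map_sub, LinearMap.sub_apply, sub_eq_zero]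
    calc β (D W (D X (e X'))) (e Y) = β (B X X') (B W Y) := by rw [hself W, hDe, hDe]
      _ = β (B W X') (B X Y) := hflat _ _ _ _
      _ = β (D X (D W (e X'))) (e Y) := by rw [hself X, hDe, hDe]
  refine re_apply_self_nonneg_of_exists_eigenvector hβ hstar hself (fun T hT hinv => ?_)
    (T := ⊤) (fun _ _ _ => Submodule.mem_top) Submodule.mem_top hv
  obtain ⟨ξ, hξT, hξ, heig⟩ := exists_common_eigenvector hcomm hT hinv
  obtain ⟨Y, rfl⟩ := e.surjective ξ
  have hY : D Y (e Y) = B Y Y := hDe Y Y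
  refine ⟨B Y Y, hY ▸ hinv Y hξT, hherm Y Y, hpos Y fun h => hξ (by rw [h, map_zero]), fun W => ?_⟩
  obtain ⟨c, hc⟩ := heig W
  exact ⟨c, by rw [← hY, ← End.mul_apply, (hcomm W Y).eq, End.mul_apply, hc, map_smul]⟩

end Hermitian

end FlatHermitian

/-! ### Second fundamental forms of Kaehler type -/

section ComplexForm

open Module

variable {ι N : Type*} [AddCommGroup N] [Module ℝ N] (e : Basis ι ℝ N)

/-- The real-linear map into `ℂ^ι` given by the coordinates in a basis, which models the inclusion
of a real vector space into its complexification. -/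
noncomputable def complexCoord : N →ₗ[ℝ] ι → ℂ :=
  (Complex.ofRealCLM : ℝ →ₗ[ℝ] ℂ).compLeft ι ∘ₗ Finsupp.lcoeFun ∘ₗ (e.repr : N →ₗ[ℝ] ι →₀ ℝ)

@[simp]
theorem complexCoord_apply (x : N) (a : ι) : complexCoord e x a = e.repr x a := rfl

@[simp]
theorem star_complexCoord (x : N) : star (complexCoord e x) = complexCoord e x := by
  ext a
  simp

variable [Fintype ι] [DecidableEq ι] (b : LinearMap.BilinForm ℝ N)

/-- The complex bilinear extension of a real bilinear form along `complexCoord`. -/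
noncomputable def complexForm : LinearMap.BilinForm ℂ (ι → ℂ) :=
  Matrix.toBilin' ((LinearMap.BilinForm.toMatrix e b).map (↑))

theorem complexForm_apply (x y : ι → ℂ) :
    complexForm e b x y = ∑ i, ∑ j, x i * b (e i) (e j) * y j := by
  simp [complexForm, Matrix.toBilin'_apply, LinearMap.BilinForm.toMatrix_apply]

@[simp]
theorem complexForm_complexCoord (x y : N) :
    complexForm e b (complexCoord e x) (complexCoord e y) = b x y := by
  rw [complexForm_apply]
  conv_rhs => rw [← e.sum_repr x, ← e.sum_repr y]
  simp only [complexCoord_apply, map_sum, map_smul, LinearMap.sum_apply, LinearMap.smul_apply,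
    smul_eq_mul, Complex.ofReal_sum, Complex.ofReal_mul, Finset.mul_sum]
  rw [Finset.sum_comm]
  refine Finset.sum_congr rfl fun j _ => Finset.sum_congr rfl fun i _ => ?_
  ring

theorem complexForm_star (x y : ι → ℂ) :
    complexForm e b (star x) (star y) = star (complexForm e b x y) := by
  simp [complexForm_apply]

variable {b}

theorem complexForm_isSymm (hb : b.IsSymm) : (complexForm e b).IsSymm := ⟨fun x y => by
  rw [complexForm_apply, complexForm_apply, Finset.sum_comm]
  refine Finset.sum_congr rfl fun j _ => Finset.sum_congr rfl fun i _ => ?_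
  have hij : b (e j) (e i) = b (e i) (e j) := hb.eq _ _
  rw [hij]
  ring⟩

theorem complexForm_nondegenerate (hb : b.Nondegenerate) : (complexForm e b).Nondegenerate := by
  refine LinearMap.BilinForm.nondegenerate_toBilin'_of_det_ne_zero' _ ?_
  have hdet := (LinearMap.BilinForm.nondegenerate_iff_det_ne_zero e).mp hb
  rwa [← Complex.coe_algebraMap, ← RingHom.mapMatrix_apply, ← RingHom.map_det,
    map_ne_zero_iff _ (algebraMap ℝ ℂ).injective]

end ComplexForm

section GaussTensor

variable {V N : Type*} [AddCommGroup V] [Module ℝ V] [AddCommGroup N] [Module ℝ N]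

/-- The curvature tensor `⟨R(X, Y)Z, W⟩` that the Gauss equation assigns to a second fundamental
form `α` with values in a space with scalar product `b`. -/
def gaussTensor (b : LinearMap.BilinForm ℝ N) (α : V →ₗ[ℝ] V →ₗ[ℝ] N) (X Y Z W : V) : ℝ :=
  b (α X W) (α Y Z) - b (α X Z) (α Y W)

end GaussTensor

section Sesquilinear

theorem apply_I_smul_left_of_invariant {V N : Type*} [AddCommGroup V] [Module ℝ V] [Module ℂ V]
    [AddCommGroup N] [Module ℝ N] {H : V →ₗ[ℝ] V →ₗ[ℝ] N}
    (hH : ∀ X Y, H (Complex.I • X) (Complex.I • Y) = H X Y) (X Y : V) :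
    H (Complex.I • X) Y = -H X (Complex.I • Y) := by
  rw [← hH X, smul_smul, Complex.I_mul_I, neg_one_smul, map_neg, neg_neg]

theorem apply_self_I_smul_of_invariant {V N : Type*} [AddCommGroup V] [Module ℝ V]
    [Module ℂ V] [AddCommGroup N] [Module ℝ N] {H : V →ₗ[ℝ] V →ₗ[ℝ] N}
    (hcomm : ∀ X Y, H X Y = H Y X)
    (hH : ∀ X Y, H (Complex.I • X) (Complex.I • Y) = H X Y) (X : V) : H X (Complex.I • X) = 0 := by
  have : IsAddTorsionFree N := .of_isTorsionFree ℝ N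
  exact self_eq_neg.mp ((hcomm _ _).trans (apply_I_smul_left_of_invariant hH X X))

variable {V N L : Type*} [AddCommGroup V] [Module ℝ V] [Module ℂ V] [IsScalarTower ℝ ℂ V]
  [AddCommGroup N] [Module ℝ N] [AddCommGroup L] [Module ℂ L] [Module ℝ L] [IsScalarTower ℝ ℂ L]

theorem complex_smul_eq_re_smul_add_im_smul_I_smul (c : ℂ) (X : V) :
    c • X = c.re • X + c.im • Complex.I • X := by
  have hreal (r : ℝ) (Y : V) : (r : ℂ) • Y = r • Y := algebraMap_smul ℂ r Y
  conv_lhs => rw [← Complex.re_add_im c, add_smul, mul_smul, hreal, hreal]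

/-- The sesquilinear form `(Y, X) ↦ H(X, Y) + i H(X, iY)` with real part a real bilinear map `H`
that is invariant under multiplication by `i`. It is conjugate-linear in `Y` and takes values in a
complex space `L` that receives the target of `H` through `κ`, typically its complexification. -/
noncomputable def sesquilinearOfInvariant (κ : N →ₗ[ℝ] L) (H : V →ₗ[ℝ] V →ₗ[ℝ] N)
    (hH : ∀ X Y, H (Complex.I • X) (Complex.I • Y) = H X Y) : V →ₗ⋆[ℂ] V →ₗ[ℂ] L :=
  LinearMap.mk₂'ₛₗ (starRingEnd ℂ) (RingHom.id ℂ)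
    (fun Y X => κ (H X Y) + Complex.I • κ (H X (Complex.I • Y)))
    (fun Y Y' X => by simp only [smul_add, map_add]; abel)
    (fun c Y X => by
      rw [smul_comm Complex.I c, complex_smul_eq_re_smul_add_im_smul_I_smul c Y,
        complex_smul_eq_re_smul_add_im_smul_I_smul c (Complex.I • Y),
        complex_smul_eq_re_smul_add_im_smul_I_smul (starRingEnd ℂ c),
        smul_smul Complex.I Complex.I Y]
      simp only [Complex.I_mul_I, neg_smul, one_smul, map_add, map_neg, map_smul,
        Complex.conj_re, Complex.conj_im]
      match_scalars <;>
        simp only [Complex.coe_algebraMap, mul_one, mul_neg, Complex.I_mul_I] <;> ring)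
    (fun Y X X' => by simp only [map_add, LinearMap.add_apply, smul_add]; abel)
    (fun c Y X => by
      rw [RingHom.id_apply, complex_smul_eq_re_smul_add_im_smul_I_smul c X,
        complex_smul_eq_re_smul_add_im_smul_I_smul c (κ _ + _)]
      simp only [map_add, LinearMap.add_apply, map_smul, LinearMap.smul_apply, hH]
      simp only [apply_I_smul_left_of_invariant hH, map_neg]
      match_scalars <;> simp [-Complex.re_add_im] <;> ring)

theorem sesquilinearOfInvariant_apply (κ : N →ₗ[ℝ] L) {H : V →ₗ[ℝ] V →ₗ[ℝ] N}
    (hH : ∀ X Y, H (Complex.I • X) (Complex.I • Y) = H X Y) (Y X : V) :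
    sesquilinearOfInvariant κ H hH Y X = κ (H X Y) + Complex.I • κ (H X (Complex.I • Y)) := rfl

/-- The part of type `(1, 1)`, up to the factor `1 / 2`, of a real bilinear map on a complex vector
space. -/
noncomputable def invariantPart (α : V →ₗ[ℝ] V →ₗ[ℝ] N) : V →ₗ[ℝ] V →ₗ[ℝ] N :=
  α + α.compl₁₂ (Algebra.lsmul ℝ ℝ V Complex.I) (Algebra.lsmul ℝ ℝ V Complex.I)

theorem invariantPart_apply (α : V →ₗ[ℝ] V →ₗ[ℝ] N) (X Y : V) :
    invariantPart α X Y = α X Y + α (Complex.I • X) (Complex.I • Y) := rfl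

theorem invariantPart_I_smul (α : V →ₗ[ℝ] V →ₗ[ℝ] N) (X Y : V) :
    invariantPart α (Complex.I • X) (Complex.I • Y) = invariantPart α X Y := by
  simp only [invariantPart_apply, smul_smul, Complex.I_mul_I, neg_one_smul, map_neg,
    LinearMap.neg_apply, neg_neg, add_comm]

theorem invariantPart_comm {α : V →ₗ[ℝ] V →ₗ[ℝ] N} (hα : ∀ X Y, α X Y = α Y X) (X Y : V) :
    invariantPart α X Y = invariantPart α Y X := by
  rw [invariantPart_apply, invariantPart_apply, hα X, hα (Complex.I • X)]

theorem invariantPart_flat {b : LinearMap.BilinForm ℝ N} {α : V →ₗ[ℝ] V →ₗ[ℝ] N}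
    (hK : ∀ X Y Z W,
      gaussTensor b α X Y (Complex.I • Z) (Complex.I • W) = gaussTensor b α X Y Z W) (X Y Z W : V) :
    b (invariantPart α X Y) (invariantPart α Z W)
        - b (invariantPart α X (Complex.I • Y)) (invariantPart α Z (Complex.I • W))
      = b (invariantPart α X W) (invariantPart α Z Y)
        - b (invariantPart α X (Complex.I • W)) (invariantPart α Z (Complex.I • Y)) := by
  have h₁ := hK X Z W Y
  have h₂ := hK (Complex.I • X) (Complex.I • Z) W Y
  have h₃ := hK X (Complex.I • Z) (Complex.I • W) Y
  have h₄ := hK (Complex.I • X) Z (Complex.I • W) Y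
  simp only [gaussTensor, invariantPart_apply, smul_smul, Complex.I_mul_I, neg_one_smul, map_neg,
    map_add, LinearMap.neg_apply, LinearMap.add_apply] at h₁ h₂ h₃ h₄ ⊢
  linarith

end Sesquilinear

section FlatCurvature

open Module

theorem apply_self_nonneg_of_gaussTensor_invariant {V N : Type*} [AddCommGroup V] [Module ℝ V]
    [Module ℂ V] [IsScalarTower ℝ ℂ V] [AddCommGroup N] [Module ℝ N] [FiniteDimensional ℝ N]
    {b : LinearMap.BilinForm ℝ N} (hb : b.IsSymm) (hnd : b.Nondegenerate)
    (hdim : finrank ℝ N ≤ finrank ℂ V) {α : V →ₗ[ℝ] V →ₗ[ℝ] N} (hα : ∀ X Y, α X Y = α Y X)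
    (hK : ∀ X Y Z W,
      gaussTensor b α X Y (Complex.I • Z) (Complex.I • W) = gaussTensor b α X Y Z W)
    (hpos : ∀ X, X ≠ 0 → 0 < b (invariantPart α X X) (invariantPart α X X)) (v : N) :
    0 ≤ b v v := by
  let e := finBasis ℝ N
  let H := invariantPart α
  have hcomm : ∀ X Y, H X Y = H Y X := invariantPart_comm hα
  have hinv : ∀ X Y, H (Complex.I • X) (Complex.I • Y) = H X Y := invariantPart_I_smul α
  let B := sesquilinearOfInvariant (complexCoord e) H hinv
  have hB_self (X : V) : B X X = complexCoord e (H X X) := by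
    simp [B, sesquilinearOfInvariant_apply, apply_self_I_smul_of_invariant hcomm hinv]
  have hB_herm (X Y : V) : star (B X Y) = B Y X := by
    simp only [B, sesquilinearOfInvariant_apply, star_add, star_smul, star_complexCoord]
    simp [hcomm X Y, hcomm X (Complex.I • Y), apply_I_smul_left_of_invariant hinv]
  have hB_flat (X Y Z W : V) :
      complexForm e b (B Y X) (B W Z) = complexForm e b (B W X) (B Y Z) := by
    have hre := invariantPart_flat hK X Y Z W
    have him := invariantPart_flat hK X Y Z (Complex.I • W)
    simp only [smul_smul, Complex.I_mul_I, neg_one_smul, map_neg, LinearMap.neg_apply] at him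
    simp only [B, sesquilinearOfInvariant_apply, map_add, map_smul, LinearMap.add_apply,
      LinearMap.smul_apply, complexForm_complexCoord]
    refine Complex.ext ?_ ?_ <;>
      simp only [smul_eq_mul, Complex.add_re, Complex.add_im, Complex.mul_re, Complex.mul_im,
        Complex.I_re, Complex.I_im, Complex.ofReal_re, Complex.ofReal_im, zero_mul, one_mul,
        mul_zero, zero_add, add_zero, sub_self, zero_sub] <;>
      linarith
  have hv := re_apply_self_nonneg_of_flat_hermitian (complexForm_isSymm e hb)
    (complexForm_nondegenerate e hnd) (complexForm_star e b)
    (by rwa [finrank_fin_fun]) hB_herm hB_flat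
    (fun X hX => by simpa [hB_self] using hpos X hX) (star_complexCoord e v)
  simpa using hv

end FlatCurvature

section NormalSpace

open Module

variable {V F : Type*} [AddCommGroup V] [Module ℝ V] [AddCommGroup F] [Module ℝ F]
  {b : LinearMap.BilinForm ℝ F} {t : V →ₗ[ℝ] F}

theorem injective_of_forall_apply_self_pos (ht : ∀ X, X ≠ 0 → 0 < b (t X) (t X)) :
    Function.Injective t :=
  (injective_iff_map_eq_zero t).mpr fun X hX => by
    by_contra h
    simpa [hX] using ht X h

theorem restrict_orthogonal_range_nondegenerate [FiniteDimensional ℝ F] (hb : b.IsSymm)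
    (hnd : b.Nondegenerate) (ht : ∀ X, X ≠ 0 → 0 < b (t X) (t X)) :
    (b.restrict (b.orthogonal (LinearMap.range t))).Nondegenerate := by
  refine b.nondegenerate_restrict_of_disjoint_orthogonal hb.isRefl ?_
  rw [LinearMap.BilinForm.orthogonal_orthogonal hnd hb.isRefl, Submodule.disjoint_def]
  rintro _ hX ⟨X, rfl⟩
  by_contra h
  have hX0 : X ≠ 0 := fun h0 => h (by rw [h0, map_zero])
  exact (ht X hX0).ne' (LinearMap.BilinForm.mem_orthogonal_iff.mp hX _ ⟨X, rfl⟩)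

theorem apply_self_nonneg_of_normal [Module ℂ V] [IsScalarTower ℝ ℂ V] [FiniteDimensional ℝ F]
    (hb : b.IsSymm) (hnd : b.Nondegenerate) (ht : ∀ X, X ≠ 0 → 0 < b (t X) (t X))
    (hdim : finrank ℝ F ≤ finrank ℝ V + finrank ℂ V) {α : V →ₗ[ℝ] V →ₗ[ℝ] F}
    (hα : ∀ X Y, α X Y = α Y X) (hαt : ∀ X Y Z, b (α X Y) (t Z) = 0)
    (hK : ∀ X Y Z W,
      gaussTensor b α X Y (Complex.I • Z) (Complex.I • W) = gaussTensor b α X Y Z W)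
    (hpos : ∀ X, X ≠ 0 → 0 < b (invariantPart α X X) (invariantPart α X X)) {v : F}
    (hv : ∀ X, b v (t X) = 0) : 0 ≤ b v v := by
  let N := b.orthogonal (LinearMap.range t)
  have hmem {w : F} (hw : ∀ X, b w (t X) = 0) : w ∈ N := by
    rintro _ ⟨X, rfl⟩
    exact (hb.eq _ _).trans (hw X)
  have hdimN : finrank ℝ N ≤ finrank ℂ V := by
    rw [LinearMap.BilinForm.finrank_orthogonal hnd,
      LinearMap.finrank_range_of_inj (injective_of_forall_apply_self_pos ht)]
    omega
  let αN : V →ₗ[ℝ] V →ₗ[ℝ] N := LinearMap.mk₂ ℝ (fun X Y => ⟨α X Y, hmem (hαt X Y)⟩)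
    (fun X Y Z => Subtype.ext (by simp)) (fun c X Y => Subtype.ext (by simp))
    (fun X Y Z => Subtype.ext (by simp)) (fun c X Y => Subtype.ext (by simp))
  exact apply_self_nonneg_of_gaussTensor_invariant (b := b.restrict N) ⟨fun x y => hb.eq x y⟩
    (restrict_orthogonal_range_nondegenerate hb hnd ht) hdimN (α := αN)
    (fun X Y => Subtype.ext (hα X Y)) hK hpos ⟨v, hmem hv⟩

end NormalSpace

section Lorentz

open Module

variable {m : ℕ}

/-- The Lorentzian inner product as a bilinear form. -/
noncomputable def lorentzForm (m : ℕ) : LinearMap.BilinForm ℝ (LorentzSpace m) :=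
  LinearMap.mk₂ ℝ lorentzInner
    (fun x y z => by
      simp only [lorentzInner, Prod.fst_add, Prod.snd_add, inner_add_left]; ring)
    (fun c x y => by
      simp only [lorentzInner, Prod.smul_fst, smul_eq_mul, Prod.smul_snd, real_inner_smul_left]
      ring)
    (fun x y z => by
      simp only [lorentzInner, Prod.fst_add, Prod.snd_add, inner_add_right]; ring)
    (fun c x y => by
      simp only [lorentzInner, Prod.smul_fst, smul_eq_mul, Prod.smul_snd, inner_smul_right]; ring)

theorem lorentzForm_apply (v w : LorentzSpace m) : lorentzForm m v w = lorentzInner v w := rfl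

theorem lorentzForm_isSymm (m : ℕ) : (lorentzForm m).IsSymm :=
  ⟨fun v w => by simp [lorentzForm_apply, lorentzInner, real_inner_comm v.2, mul_comm]⟩

theorem lorentzForm_comm (v w : LorentzSpace m) : lorentzForm m v w = lorentzForm m w v :=
  (lorentzForm_isSymm m).eq v w

theorem lorentzForm_nondegenerate (m : ℕ) : (lorentzForm m).Nondegenerate := by
  refine (lorentzForm_isSymm m).isRefl.nondegenerate_iff_separatingLeft.mpr fun v hv => ?_
  have h_time := hv (1, 0)
  have h_space := hv (0, v.2)
  simp only [lorentzForm_apply, lorentzInner, mul_one, inner_zero_right, add_zero, neg_eq_zero,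
    mul_zero, neg_zero, zero_add, inner_self_eq_zero] at h_time h_space
  exact Prod.ext h_time h_space

theorem lorentzForm_self_nonneg_of_orthogonal {v w : LorentzSpace m} (hv : lorentzForm m v v < 0)
    (hvw : lorentzForm m v w = 0) : 0 ≤ lorentzForm m w w := by
  simp only [lorentzForm_apply, lorentzInner, real_inner_self_eq_norm_sq] at hv hvw ⊢
  have hv_time : 0 < v.1 ^ 2 := by nlinarith [sq_nonneg ‖v.2‖]
  have hw_time : v.1 ^ 2 * w.1 ^ 2 ≤ v.1 ^ 2 * ‖w.2‖ ^ 2 := calc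
    v.1 ^ 2 * w.1 ^ 2 = |inner ℝ v.2 w.2| ^ 2 := by
      rw [sq_abs, ← mul_pow, neg_add_eq_zero.mp hvw]
    _ ≤ (‖v.2‖ * ‖w.2‖) ^ 2 := by gcongr; exact abs_real_inner_le_norm _ _
    _ = ‖v.2‖ ^ 2 * ‖w.2‖ ^ 2 := mul_pow _ _ _
    _ ≤ v.1 ^ 2 * ‖w.2‖ ^ 2 := by gcongr ?_ * _; linarith
  linarith [le_of_mul_le_mul_left hw_time hv_time]

/-- The pointwise second-order data of an isometric immersion into the hyperboloid: `φ` is the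
position vector, `t` the differential, and `α` the second fundamental form of the immersion into
the ambient Lorentzian space. -/
structure IsHyperbolicTwoJet {V : Type*} [AddCommGroup V] [Module ℝ V] (φ : LorentzSpace m)
    (t : V →ₗ[ℝ] LorentzSpace m) (α : V →ₗ[ℝ] V →ₗ[ℝ] LorentzSpace m) : Prop where
  position_self : lorentzForm m φ φ < 0
  position_tangent : ∀ X, lorentzForm m φ (t X) = 0
  tangent_pos : ∀ X, X ≠ 0 → 0 < lorentzForm m (t X) (t X)
  comm : ∀ X Y, α X Y = α Y X
  normal : ∀ X Y Z, lorentzForm m (α X Y) (t Z) = 0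
  position_apply : ∀ X Y, lorentzForm m φ (α X Y) = -lorentzForm m (t X) (t Y)

namespace IsHyperbolicTwoJet

variable {V : Type*} [AddCommGroup V] [Module ℝ V] [Module ℂ V]
  {φ : LorentzSpace m} {t : V →ₗ[ℝ] LorentzSpace m} {α : V →ₗ[ℝ] V →ₗ[ℝ] LorentzSpace m}

theorem gaussTensor_le_invariantPart_self [IsScalarTower ℝ ℂ V] (h : IsHyperbolicTwoJet φ t α)
    (hI : ∀ X Y, lorentzForm m (t (Complex.I • X)) (t (Complex.I • Y)) = lorentzForm m (t X) (t Y))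
    (X : V) :
    4 * gaussTensor (lorentzForm m) α X (Complex.I • X) (Complex.I • X) X
      ≤ lorentzForm m (invariantPart α X X) (invariantPart α X X) := by
  have h_mixed : 0 ≤ lorentzForm m (α X (Complex.I • X)) (α X (Complex.I • X)) := by
    refine lorentzForm_self_nonneg_of_orthogonal h.position_self ?_
    have htI := hI X (Complex.I • X)
    rw [smul_smul, Complex.I_mul_I, neg_one_smul, map_neg, map_neg, lorentzForm_comm] at htI
    rw [h.position_apply]
    linarith
  have h_diff : 0 ≤ lorentzForm m (α X X - α (Complex.I • X) (Complex.I • X))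
      (α X X - α (Complex.I • X) (Complex.I • X)) := by
    refine lorentzForm_self_nonneg_of_orthogonal h.position_self ?_
    rw [map_sub, h.position_apply, h.position_apply, hI, sub_self]
  have hcomm := lorentzForm_comm (α X X) (α (Complex.I • X) (Complex.I • X))
  simp only [gaussTensor, invariantPart_apply, h.comm (Complex.I • X) X, map_add, map_sub,
    LinearMap.add_apply, LinearMap.sub_apply] at h_diff ⊢
  linarith

theorem exists_gaussTensor_nonpos [IsScalarTower ℝ ℂ V] (h : IsHyperbolicTwoJet φ t α)
    (hdim : m + 1 ≤ finrank ℝ V + finrank ℂ V)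
    (hI : ∀ X Y, lorentzForm m (t (Complex.I • X)) (t (Complex.I • Y)) = lorentzForm m (t X) (t Y))
    (hK : ∀ X Y Z W, gaussTensor (lorentzForm m) α X Y (Complex.I • Z) (Complex.I • W)
      = gaussTensor (lorentzForm m) α X Y Z W) :
    ∃ X ≠ 0, gaussTensor (lorentzForm m) α X (Complex.I • X) (Complex.I • X) X ≤ 0 := by
  by_contra! hpos
  refine h.position_self.not_ge <| apply_self_nonneg_of_normal (lorentzForm_isSymm m)
    (lorentzForm_nondegenerate m) h.tangent_pos (by simpa [add_comm] using hdim) h.comm h.normal hK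
    (fun X hX => ?_) h.position_tangent
  linarith [hpos X hX, h.gaussTensor_le_invariantPart_self hI X]

end IsHyperbolicTwoJet

end Lorentz

/-! ### Connections and immersions in coordinates -/

section PartialDeriv

variable {d : ℕ} {F F' F'' : Type*} [NormedAddCommGroup F] [NormedSpace ℝ F]
  [NormedAddCommGroup F'] [NormedSpace ℝ F'] [NormedAddCommGroup F''] [NormedSpace ℝ F'']

/-- The partial derivative `∂_i ψ` of a vector-valued function on `ℝ^d`; for real functions this is
`coordDeriv`. -/
noncomputable def partialDeriv (i : Fin d) (ψ : EuclideanSpace ℝ (Fin d) → F)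
    (u : EuclideanSpace ℝ (Fin d)) : F :=
  fderiv ℝ ψ u (EuclideanSpace.single i 1)

variable {O : Set (EuclideanSpace ℝ (Fin d))} {u : EuclideanSpace ℝ (Fin d)}

theorem differentiableAt_of_contDiffOn {E : Type*} [NormedAddCommGroup E] [NormedSpace ℝ E]
    {O : Set E} {ψ : E → F} {u : E} (hO : IsOpen O) (hψ : ContDiffOn ℝ ∞ ψ O) (hu : u ∈ O) :
    DifferentiableAt ℝ ψ u :=
  (hψ.contDiffAt (hO.mem_nhds hu)).differentiableAt (by simp)

theorem contDiffOn_partialDeriv {ψ : EuclideanSpace ℝ (Fin d) → F} (hO : IsOpen O)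
    (hψ : ContDiffOn ℝ ∞ ψ O) (i : Fin d) : ContDiffOn ℝ ∞ (partialDeriv i ψ) O :=
  (hψ.fderiv_of_isOpen hO (by simp)).clm_apply contDiffOn_const

theorem partialDeriv_congr {ψ χ : EuclideanSpace ℝ (Fin d) → F} (hO : IsOpen O) (hu : u ∈ O)
    (h : Set.EqOn ψ χ O) (i : Fin d) : partialDeriv i ψ u = partialDeriv i χ u := by
  rw [partialDeriv, partialDeriv, (h.eventuallyEq_of_mem (hO.mem_nhds hu)).fderiv_eq]

theorem partialDeriv_const (i : Fin d) (c : F) : partialDeriv i (fun _ => c) u = 0 := by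
  simp [partialDeriv]

theorem partialDeriv_comm {ψ : EuclideanSpace ℝ (Fin d) → F} (hO : IsOpen O)
    (hψ : ContDiffOn ℝ ∞ ψ O) (hu : u ∈ O) (i j : Fin d) :
    partialDeriv i (partialDeriv j ψ) u = partialDeriv j (partialDeriv i ψ) u := by
  have hfderiv : DifferentiableAt ℝ (fderiv ℝ ψ) u :=
    differentiableAt_of_contDiffOn hO (hψ.fderiv_of_isOpen hO (by simp)) hu
  have hsymm : IsSymmSndFDerivAt ℝ ψ u :=
    (hψ.contDiffAt (hO.mem_nhds hu)).isSymmSndFDerivAt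
      (by rw [minSmoothness_of_isRCLikeNormedField]; exact WithTop.coe_le_coe.mpr le_top)
  have hsnd (i j : Fin d) : partialDeriv i (partialDeriv j ψ) u =
      fderiv ℝ (fderiv ℝ ψ) u (EuclideanSpace.single i 1) (EuclideanSpace.single j 1) := by
    change fderiv ℝ (fun v => fderiv ℝ ψ v (EuclideanSpace.single j 1)) u _ = _
    rw [fderiv_clm_apply hfderiv (differentiableAt_const _)]
    simp
  rw [hsnd, hsnd, hsymm.eq]

theorem partialDeriv_clm_comp (L : F →L[ℝ] F') {ψ : EuclideanSpace ℝ (Fin d) → F}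
    (hψ : DifferentiableAt ℝ ψ u) (i : Fin d) :
    partialDeriv i (fun v => L (ψ v)) u = L (partialDeriv i ψ u) :=
  DFunLike.congr_fun (L.hasFDerivAt.comp u hψ.hasFDerivAt).fderiv _

theorem partialDeriv_bilin (b : F →L[ℝ] F' →L[ℝ] F'') {ψ : EuclideanSpace ℝ (Fin d) → F}
    {χ : EuclideanSpace ℝ (Fin d) → F'} (hψ : DifferentiableAt ℝ ψ u)
    (hχ : DifferentiableAt ℝ χ u) (i : Fin d) :
    partialDeriv i (fun v => b (ψ v) (χ v)) u =
      b (partialDeriv i ψ u) (χ u) + b (ψ u) (partialDeriv i χ u) := by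
  rw [partialDeriv, (b.hasFDerivAt_of_bilinear hψ.hasFDerivAt hχ.hasFDerivAt).fderiv]
  simp [partialDeriv, add_comm]

theorem partialDeriv_bilinForm [FiniteDimensional ℝ F] (b : LinearMap.BilinForm ℝ F)
    {ψ χ : EuclideanSpace ℝ (Fin d) → F} (hψ : DifferentiableAt ℝ ψ u)
    (hχ : DifferentiableAt ℝ χ u) (i : Fin d) :
    partialDeriv i (fun v => b (ψ v) (χ v)) u =
      b (partialDeriv i ψ u) (χ u) + b (ψ u) (partialDeriv i χ u) :=
  partialDeriv_bilin b.toContinuousBilinearMap hψ hχ i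

theorem partialDeriv_smul {c : EuclideanSpace ℝ (Fin d) → ℝ} {ψ : EuclideanSpace ℝ (Fin d) → F}
    (hc : DifferentiableAt ℝ c u) (hψ : DifferentiableAt ℝ ψ u) (i : Fin d) :
    partialDeriv i (fun v => c v • ψ v) u =
      partialDeriv i c u • ψ u + c u • partialDeriv i ψ u :=
  partialDeriv_bilin (.lsmul ℝ ℝ) hc hψ i

theorem partialDeriv_mul {𝔸 : Type*} [NormedRing 𝔸] [NormedAlgebra ℝ 𝔸]
    {ψ χ : EuclideanSpace ℝ (Fin d) → 𝔸} (hψ : DifferentiableAt ℝ ψ u)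
    (hχ : DifferentiableAt ℝ χ u) (i : Fin d) :
    partialDeriv i (fun v => ψ v * χ v) u = partialDeriv i ψ u * χ u + ψ u * partialDeriv i χ u :=
  partialDeriv_bilin (.mul ℝ 𝔸) hψ hχ i

theorem partialDeriv_sub {ψ χ : EuclideanSpace ℝ (Fin d) → F} (hψ : DifferentiableAt ℝ ψ u)
    (hχ : DifferentiableAt ℝ χ u) (i : Fin d) :
    partialDeriv i (fun v => ψ v - χ v) u = partialDeriv i ψ u - partialDeriv i χ u := by
  rw [partialDeriv, fderiv_fun_sub hψ hχ]
  rfl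

theorem partialDeriv_sum {κ : Type*} [Fintype κ] {ψ : κ → EuclideanSpace ℝ (Fin d) → F}
    (hψ : ∀ k, DifferentiableAt ℝ (ψ k) u) (i : Fin d) :
    partialDeriv i (fun v => ∑ k, ψ k v) u = ∑ k, partialDeriv i (ψ k) u := by
  rw [partialDeriv, fderiv_fun_sum fun k _ => hψ k]
  simp [partialDeriv]

end PartialDeriv

section MatrixValued

open scoped Matrix.Norms.Operator

variable {E ι : Type*} [NormedAddCommGroup E] [NormedSpace ℝ E] [Fintype ι]
  {O : Set E} {A : E → Matrix ι ι ℝ}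

theorem contDiffOn_matrix_apply (hA : ContDiffOn ℝ ∞ A O) (k j : ι) :
    ContDiffOn ℝ ∞ (fun v => A v k j) O :=
  (Matrix.entryLinearMap ℝ ℝ k j).toContinuousLinearMap.contDiff.comp_contDiffOn hA

theorem partialDeriv_matrix_apply {d : ℕ} {A : EuclideanSpace ℝ (Fin d) → Matrix ι ι ℝ}
    {u : EuclideanSpace ℝ (Fin d)} (hA : DifferentiableAt ℝ A u) (i : Fin d) (k j : ι) :
    partialDeriv i (fun v => A v k j) u = partialDeriv i A u k j :=
  partialDeriv_clm_comp (Matrix.entryLinearMap ℝ ℝ k j).toContinuousLinearMap hA i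

theorem contDiffOn_matrix_of_apply (hA : ∀ k j, ContDiffOn ℝ ∞ (fun v => A v k j) O) :
    ContDiffOn ℝ ∞ A O := by
  classical
  have hsum : A = fun v => ∑ k, ∑ j, A v k j • Matrix.single k j (1 : ℝ) := by
    ext1 v
    simpa using Matrix.matrix_eq_sum_single (A v)
  rw [hsum]
  exact ContDiffOn.sum fun k _ => ContDiffOn.sum fun j _ => (hA k j).smul contDiffOn_const

theorem contDiffOn_matrix_inv [DecidableEq ι] (hA : ContDiffOn ℝ ∞ A O)
    (hdet : ∀ v ∈ O, (A v).det ≠ 0) :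
    ContDiffOn ℝ ∞ (fun v => (A v)⁻¹) O := by
  intro v hv
  have : CompleteSpace (Matrix ι ι ℝ) := FiniteDimensional.complete ℝ _
  obtain ⟨a, ha⟩ := (Matrix.isUnit_iff_isUnit_det _).mpr (hdet v hv).isUnit
  simp only [Matrix.nonsing_inv_eq_ringInverse]
  exact ContDiffAt.comp_contDiffWithinAt v (ha ▸ contDiffAt_ringInverse ℝ a) (hA v hv)

end MatrixValued

section Connection

open scoped Matrix.Norms.Operator

variable {d : ℕ} {O : Set (EuclideanSpace ℝ (Fin d))} {u : EuclideanSpace ℝ (Fin d)}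

/-- The curvature `R(∂_i, ∂_j)` of the connection `∂_i + A_i`, where the `A_i` act by
multiplication. -/
noncomputable def connectionCurvature {𝔸 : Type*} [NormedRing 𝔸] [NormedAlgebra ℝ 𝔸]
    (A : Fin d → EuclideanSpace ℝ (Fin d) → 𝔸) (i j : Fin d) (u : EuclideanSpace ℝ (Fin d)) : 𝔸 :=
  partialDeriv i (A j) u - partialDeriv j (A i) u + (A i u * A j u - A j u * A i u)

theorem commute_connectionCurvature_of_parallel {𝔸 : Type*} [NormedRing 𝔸] [NormedAlgebra ℝ 𝔸]
    {A : Fin d → EuclideanSpace ℝ (Fin d) → 𝔸} {J : EuclideanSpace ℝ (Fin d) → 𝔸}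
    (hO : IsOpen O) (hu : u ∈ O) (hA : ∀ i, DifferentiableAt ℝ (A i) u)
    (hJ : ContDiffOn ℝ ∞ J O)
    (hpar : ∀ v ∈ O, ∀ i, partialDeriv i J v = J v * A i v - A i v * J v) (i j : Fin d) :
    Commute (connectionCurvature A i j u) (J u) := by
  have hJu := differentiableAt_of_contDiffOn hO hJ hu
  have hsnd (i j : Fin d) : partialDeriv j (partialDeriv i J) u =
      (J u * A j u - A j u * J u) * A i u + J u * partialDeriv j (A i) u
        - (partialDeriv j (A i) u * J u + A i u * (J u * A j u - A j u * J u)) := by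
    rw [partialDeriv_congr hO hu (fun v hv => hpar v hv i),
      partialDeriv_sub (hJu.fun_mul (hA i)) ((hA i).fun_mul hJu), partialDeriv_mul hJu (hA i),
      partialDeriv_mul (hA i) hJu, hpar u hu]
  have hcomm := partialDeriv_comm hO hJ hu i j
  rw [hsnd, hsnd, ← sub_eq_zero] at hcomm
  rw [commute_iff_eq, connectionCurvature, ← sub_eq_zero, ← neg_eq_zero, ← hcomm]
  noncomm_ring

/-- The matrices `(Γ_i)_{kj} = Γ^k_{ij}` of the Levi-Civita connection of a metric with components
`G` on an open subset of `ℝ^d`. -/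
noncomputable def leviCivitaMatrix (G : EuclideanSpace ℝ (Fin d) → Matrix (Fin d) (Fin d) ℝ)
    (i : Fin d) (u : EuclideanSpace ℝ (Fin d)) : Matrix (Fin d) (Fin d) ℝ :=
  Matrix.of fun k j => (1 / 2) * ∑ l, (G u)⁻¹ k l *
    (partialDeriv i (fun v => G v j l) u + partialDeriv j (fun v => G v i l) u
      - partialDeriv l (fun v => G v i j) u)

theorem contDiffOn_leviCivitaMatrix {G : EuclideanSpace ℝ (Fin d) → Matrix (Fin d) (Fin d) ℝ}
    (hO : IsOpen O) (hG : ContDiffOn ℝ ∞ G O) (hdet : ∀ v ∈ O, (G v).det ≠ 0) (i : Fin d) :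
    ContDiffOn ℝ ∞ (leviCivitaMatrix G i) O := by
  have hdG (i j l : Fin d) : ContDiffOn ℝ ∞ (partialDeriv i fun v => G v j l) O :=
    contDiffOn_partialDeriv hO (contDiffOn_matrix_apply hG j l) i
  exact contDiffOn_matrix_of_apply fun k j => contDiffOn_const.mul <| ContDiffOn.sum fun l _ =>
    (contDiffOn_matrix_apply (contDiffOn_matrix_inv hG hdet) k l).mul
      (((hdG i j l).add (hdG j i l)).sub (hdG l i j))

end Connection

section SecondFundamental

open scoped Matrix.Norms.Operator

variable {d : ℕ} {F : Type*} [NormedAddCommGroup F] [NormedSpace ℝ F]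
  {O : Set (EuclideanSpace ℝ (Fin d))} {u : EuclideanSpace ℝ (Fin d)}
  {φ : EuclideanSpace ℝ (Fin d) → F}
  {A : Fin d → EuclideanSpace ℝ (Fin d) → Matrix (Fin d) (Fin d) ℝ}
  {G : EuclideanSpace ℝ (Fin d) → Matrix (Fin d) (Fin d) ℝ}

/-- The components `α_{ij} = ∂_i ∂_j φ - ∑_k Γ^k_{ij} ∂_k φ` of the second fundamental form of a
map `φ` with respect to the connection with matrices `(A_i)_{kj} = Γ^k_{ij}`. -/
noncomputable def secondFundamentalCoeff
    (A : Fin d → EuclideanSpace ℝ (Fin d) → Matrix (Fin d) (Fin d) ℝ)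
    (φ : EuclideanSpace ℝ (Fin d) → F) (i j : Fin d) (u : EuclideanSpace ℝ (Fin d)) : F :=
  partialDeriv i (partialDeriv j φ) u - ∑ k, A i u k j • partialDeriv k φ u

theorem partialDeriv_partialDeriv_eq_secondFundamentalCoeff_add (i j : Fin d) :
    partialDeriv i (partialDeriv j φ) u =
      secondFundamentalCoeff A φ i j u + ∑ k, A i u k j • partialDeriv k φ u :=
  (sub_add_cancel _ _).symm

theorem secondFundamentalCoeff_comm (hO : IsOpen O) (hφ : ContDiffOn ℝ ∞ φ O) (hu : u ∈ O)
    (hA : ∀ i j k, A i u k j = A j u k i) (i j : Fin d) :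
    secondFundamentalCoeff A φ i j u = secondFundamentalCoeff A φ j i u := by
  simp only [secondFundamentalCoeff, partialDeriv_comm hO hφ hu i j, hA i j]

theorem leviCivitaMatrix_comm (hO : IsOpen O) (hu : u ∈ O) (hG : ∀ v ∈ O, (G v).IsSymm)
    (i j k : Fin d) : leviCivitaMatrix G i u k j = leviCivitaMatrix G j u k i := by
  have hsymm (l : Fin d) :
      partialDeriv l (fun v => G v i j) u = partialDeriv l (fun v => G v j i) u :=
    partialDeriv_congr hO hu (fun v hv => (hG v hv).apply j i) l
  simp only [leviCivitaMatrix, Matrix.of_apply, hsymm, add_comm]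

theorem partialDeriv_secondFundamentalCoeff (hO : IsOpen O) (hφ : ContDiffOn ℝ ∞ φ O)
    (hu : u ∈ O) (hA : ∀ i, DifferentiableAt ℝ (A i) u) (i j k : Fin d) :
    partialDeriv i (secondFundamentalCoeff A φ j k) u =
      partialDeriv i (partialDeriv j (partialDeriv k φ)) u
        - ∑ l, (partialDeriv i (A j) u l k • partialDeriv l φ u
          + A j u l k • partialDeriv i (partialDeriv l φ) u) := by
  have htangent (l : Fin d) := contDiffOn_partialDeriv hO hφ l
  have htangent_u (l : Fin d) := differentiableAt_of_contDiffOn hO (htangent l) hu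
  have hcoeff (l : Fin d) : DifferentiableAt ℝ (fun v => A j v l k) u :=
    (Matrix.entryLinearMap ℝ ℝ l k).toContinuousLinearMap.differentiableAt.comp u (hA j)
  have hterm (l : Fin d) := (hcoeff l).fun_smul (htangent_u l)
  change partialDeriv i (fun v => partialDeriv j (partialDeriv k φ) v
    - ∑ l, A j v l k • partialDeriv l φ v) u = _
  rw [partialDeriv_sub (differentiableAt_of_contDiffOn hO
      (contDiffOn_partialDeriv hO (htangent k) j) hu) (DifferentiableAt.fun_sum fun l _ => hterm l),
    partialDeriv_sum hterm]
  simp only [partialDeriv_smul (hcoeff _) (htangent_u _), partialDeriv_matrix_apply (hA j)]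

theorem contDiffOn_secondFundamentalCoeff (hO : IsOpen O) (hφ : ContDiffOn ℝ ∞ φ O)
    (hA : ∀ i, ContDiffOn ℝ ∞ (A i) O) (i j : Fin d) :
    ContDiffOn ℝ ∞ (secondFundamentalCoeff A φ i j) O :=
  (contDiffOn_partialDeriv hO (contDiffOn_partialDeriv hO hφ j) i).sub <|
    ContDiffOn.sum fun k _ => (contDiffOn_matrix_apply (hA i) k j).smul
      (contDiffOn_partialDeriv hO hφ k)

variable [FiniteDimensional ℝ F] {b : LinearMap.BilinForm ℝ F}

theorem sum_leviCivitaMatrix_mul_bilin (hO : IsOpen O) (hφ : ContDiffOn ℝ ∞ φ O)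
    (hb : b.IsSymm) (hG : ∀ v ∈ O, ∀ i j, G v i j = b (partialDeriv i φ v) (partialDeriv j φ v))
    (hu : u ∈ O) (hdet : (G u).det ≠ 0) (i j m : Fin d) :
    ∑ k, leviCivitaMatrix G i u k j * b (partialDeriv k φ u) (partialDeriv m φ u) =
      b (partialDeriv i (partialDeriv j φ) u) (partialDeriv m φ u) := by
  have hdG (i j l : Fin d) : partialDeriv i (fun v => G v j l) u =
      b (partialDeriv i (partialDeriv j φ) u) (partialDeriv l φ u) +
        b (partialDeriv i (partialDeriv l φ) u) (partialDeriv j φ u) := by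
    have htangent (l : Fin d) :=
      differentiableAt_of_contDiffOn hO (contDiffOn_partialDeriv hO hφ l) hu
    rw [partialDeriv_congr hO hu (fun v hv => hG v hv j l),
      partialDeriv_bilinForm b (htangent j) (htangent l), hb.eq (partialDeriv j φ u)]
  have hkoszul : (fun k => leviCivitaMatrix G i u k j) = (G u)⁻¹.mulVec
      fun l => b (partialDeriv i (partialDeriv j φ) u) (partialDeriv l φ u) := by
    ext k
    rw [leviCivitaMatrix, Matrix.of_apply, Finset.mul_sum]
    refine Finset.sum_congr rfl fun l _ => ?_
    rw [hdG, hdG, hdG, partialDeriv_comm hO hφ hu j i, partialDeriv_comm hO hφ hu l i,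
      partialDeriv_comm hO hφ hu l j]
    ring
  calc ∑ k, leviCivitaMatrix G i u k j * b (partialDeriv k φ u) (partialDeriv m φ u)
      = (G u).mulVec (fun k => leviCivitaMatrix G i u k j) m :=
        Finset.sum_congr rfl fun k _ => (mul_comm _ _).trans (by rw [hb.eq, ← hG u hu])
    _ = b (partialDeriv i (partialDeriv j φ) u) (partialDeriv m φ u) := by
        rw [hkoszul, Matrix.mulVec_mulVec, Matrix.mul_nonsing_inv _ hdet.isUnit, Matrix.one_mulVec]

theorem secondFundamentalCoeff_leviCivitaMatrix_normal (hO : IsOpen O) (hφ : ContDiffOn ℝ ∞ φ O)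
    (hb : b.IsSymm) (hG : ∀ v ∈ O, ∀ i j, G v i j = b (partialDeriv i φ v) (partialDeriv j φ v))
    (hu : u ∈ O) (hdet : (G u).det ≠ 0) (i j m : Fin d) :
    b (secondFundamentalCoeff (leviCivitaMatrix G) φ i j u) (partialDeriv m φ u) = 0 := by
  simp only [secondFundamentalCoeff, map_sub, map_sum, map_smul, LinearMap.sub_apply,
    LinearMap.sum_apply, LinearMap.smul_apply, smul_eq_mul,
    sum_leviCivitaMatrix_mul_bilin hO hφ hb hG hu hdet, sub_self]

theorem bilin_partialDeriv_secondFundamentalCoeff (hO : IsOpen O) (hφ : ContDiffOn ℝ ∞ φ O)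
    (hA : ∀ i, ContDiffOn ℝ ∞ (A i) O) (hb : b.IsSymm)
    (hnormal : ∀ v ∈ O, ∀ i j m,
      b (secondFundamentalCoeff A φ i j v) (partialDeriv m φ v) = 0)
    (hu : u ∈ O) (i j k m : Fin d) :
    b (partialDeriv i (secondFundamentalCoeff A φ j k) u) (partialDeriv m φ u) =
      -b (secondFundamentalCoeff A φ i m u) (secondFundamentalCoeff A φ j k u) := by
  have hdiff := partialDeriv_congr hO hu (fun v hv => hnormal v hv j k m) i
  rw [partialDeriv_const, partialDeriv_bilinForm b
    (differentiableAt_of_contDiffOn hO (contDiffOn_secondFundamentalCoeff hO hφ hA j k) hu)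
    (differentiableAt_of_contDiffOn hO (contDiffOn_partialDeriv hO hφ m) hu)] at hdiff
  rw [eq_neg_of_add_eq_zero_left hdiff,
    partialDeriv_partialDeriv_eq_secondFundamentalCoeff_add (A := A) i m]
  simp only [map_add, map_sum, map_smul, hnormal u hu, smul_zero, Finset.sum_const_zero, add_zero]
  rw [hb.eq]

theorem bilin_sum_partialDeriv_connection (hO : IsOpen O) (hφ : ContDiffOn ℝ ∞ φ O)
    (hA : ∀ i, ContDiffOn ℝ ∞ (A i) O) (hb : b.IsSymm)
    (hnormal : ∀ v ∈ O, ∀ i j m,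
      b (secondFundamentalCoeff A φ i j v) (partialDeriv m φ v) = 0)
    (hu : u ∈ O) (i j k m : Fin d) :
    ∑ l, (partialDeriv i (A j) u + A i u * A j u) l k *
        b (partialDeriv l φ u) (partialDeriv m φ u) =
      b (partialDeriv i (partialDeriv j (partialDeriv k φ)) u) (partialDeriv m φ u)
        + b (secondFundamentalCoeff A φ i m u) (secondFundamentalCoeff A φ j k u) := by
  have hA_u (i : Fin d) := differentiableAt_of_contDiffOn hO (hA i) hu
  have htangent (l : Fin d) : b (partialDeriv i (partialDeriv l φ) u) (partialDeriv m φ u) =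
      ∑ s, A i u s l * b (partialDeriv s φ u) (partialDeriv m φ u) := by
    rw [partialDeriv_partialDeriv_eq_secondFundamentalCoeff_add (A := A) i l]
    simp [hnormal u hu]
  have hweingarten := bilin_partialDeriv_secondFundamentalCoeff hO hφ hA hb hnormal hu i j k m
  rw [partialDeriv_secondFundamentalCoeff hO hφ hu hA_u] at hweingarten
  simp only [map_sub, map_sum, map_add, map_smul, LinearMap.sub_apply, LinearMap.sum_apply,
    LinearMap.add_apply, LinearMap.smul_apply, smul_eq_mul, htangent, Finset.sum_add_distrib]
    at hweingarten
  have hprod : ∑ l, (A i u * A j u) l k * b (partialDeriv l φ u) (partialDeriv m φ u) =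
      ∑ l, A j u l k * ∑ s, A i u s l * b (partialDeriv s φ u) (partialDeriv m φ u) := by
    simp only [Matrix.mul_apply, Finset.sum_mul, Finset.mul_sum]
    rw [Finset.sum_comm]
    exact Finset.sum_congr rfl fun l _ => Finset.sum_congr rfl fun s _ => by ring
  simp only [Matrix.add_apply, add_mul, Finset.sum_add_distrib, hprod]
  linarith

theorem gauss_equation (hO : IsOpen O) (hφ : ContDiffOn ℝ ∞ φ O)
    (hA : ∀ i, ContDiffOn ℝ ∞ (A i) O) (hb : b.IsSymm)
    (hnormal : ∀ v ∈ O, ∀ i j m,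
      b (secondFundamentalCoeff A φ i j v) (partialDeriv m φ v) = 0)
    (hu : u ∈ O) (i j k m : Fin d) :
    ∑ l, connectionCurvature A i j u l k * b (partialDeriv l φ u) (partialDeriv m φ u) =
      b (secondFundamentalCoeff A φ i m u) (secondFundamentalCoeff A φ j k u)
        - b (secondFundamentalCoeff A φ i k u) (secondFundamentalCoeff A φ j m u) := by
  have hij := bilin_sum_partialDeriv_connection hO hφ hA hb hnormal hu i j k m
  have hji := bilin_sum_partialDeriv_connection hO hφ hA hb hnormal hu j i k m
  rw [partialDeriv_comm hO (contDiffOn_partialDeriv hO hφ k) hu j i] at hji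
  have hsplit : connectionCurvature A i j u =
      (partialDeriv i (A j) u + A i u * A j u) - (partialDeriv j (A i) u + A j u * A i u) := by
    rw [connectionCurvature]
    abel
  simp only [hsplit, Matrix.sub_apply, sub_mul, Finset.sum_sub_distrib, hij, hji,
    hb.eq (secondFundamentalCoeff A φ i k u)]
  ring

theorem bilin_self_partialDeriv {c : ℝ} (hO : IsOpen O) (hφ : ContDiffOn ℝ ∞ φ O)
    (hb : b.IsSymm) (hc : ∀ v ∈ O, b (φ v) (φ v) = c) (hu : u ∈ O) (i : Fin d) :
    b (φ u) (partialDeriv i φ u) = 0 := by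
  have hdiff := partialDeriv_congr hO hu hc i
  have hφu := differentiableAt_of_contDiffOn hO hφ hu
  rw [partialDeriv_const, partialDeriv_bilinForm b hφu hφu, hb.eq] at hdiff
  linarith

theorem bilin_self_secondFundamentalCoeff {c : ℝ} (hO : IsOpen O) (hφ : ContDiffOn ℝ ∞ φ O)
    (hb : b.IsSymm) (hc : ∀ v ∈ O, b (φ v) (φ v) = c) (hu : u ∈ O) (i j : Fin d) :
    b (φ u) (secondFundamentalCoeff A φ i j u) =
      -b (partialDeriv i φ u) (partialDeriv j φ u) := by
  have hself (v : EuclideanSpace ℝ (Fin d)) (hv : v ∈ O) (k : Fin d) :=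
    bilin_self_partialDeriv hO hφ hb hc hv k
  have hdiff := partialDeriv_congr hO hu (fun v hv => hself v hv j) i
  rw [partialDeriv_const, partialDeriv_bilinForm b (differentiableAt_of_contDiffOn hO hφ hu)
    (differentiableAt_of_contDiffOn hO (contDiffOn_partialDeriv hO hφ j) hu)] at hdiff
  simp only [secondFundamentalCoeff, map_sub, map_sum, map_smul, hself u hu, smul_zero,
    Finset.sum_const_zero, sub_zero]
  exact eq_neg_of_add_eq_zero_right hdiff

end SecondFundamental

/-! ### Tensors in a chart -/

section Charts

open scoped Matrix.Norms.Operator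

variable {d : ℕ} {M : Type*} [TopologicalSpace M] [ChartedSpace (EuclideanSpace ℝ (Fin d)) M]

/-- The differential of the inverse of the chart at `x₀`, which turns components into tangent
vectors: it sends `v` to `∑ i, v i • ∂_i`. -/
noncomputable def chartSymmDeriv (x₀ : M) (u : EuclideanSpace ℝ (Fin d)) :
    EuclideanSpace ℝ (Fin d) →L[ℝ] TangentSpace (𝓡 d) ((extChartAt (𝓡 d) x₀).symm u) :=
  mfderiv 𝓘(ℝ, EuclideanSpace ℝ (Fin d)) (𝓡 d) (extChartAt (𝓡 d) x₀).symm u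

/-- The component map `coordComp x₀` as a continuous linear map on `T_xM`. -/
noncomputable def coordCLM (x₀ x : M) : TangentSpace (𝓡 d) x →L[ℝ] EuclideanSpace ℝ (Fin d) :=
  mfderiv (𝓡 d) 𝓘(ℝ, EuclideanSpace ℝ (Fin d)) (extChartAt (𝓡 d) x₀) x

theorem coordCLM_apply (x₀ : M) {x : M} (X : TangentSpace (𝓡 d) x) :
    coordCLM x₀ x X = coordComp x₀ X := rfl

theorem chartSymmDeriv_eq_sum (x₀ : M) (u v : EuclideanSpace ℝ (Fin d)) :
    chartSymmDeriv x₀ u v = ∑ i, v i • coordVec x₀ i u := by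
  conv_lhs => rw [← (EuclideanSpace.basisFun (Fin d) ℝ).sum_repr v]
  simp only [map_sum, map_smul, EuclideanSpace.basisFun_apply, EuclideanSpace.basisFun_repr]
  rfl

variable [IsManifold (𝓡 d) ∞ M]

theorem coordComp_chartSymmDeriv {x₀ : M} {u : EuclideanSpace ℝ (Fin d)}
    (hu : u ∈ (extChartAt (𝓡 d) x₀).target) (v : EuclideanSpace ℝ (Fin d)) :
    coordComp x₀ (chartSymmDeriv x₀ u v) = v := by
  have hcomp := mfderiv_extChartAt_comp_mfderivWithin_extChartAt_symm (I := 𝓡 d) hu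
  rw [ModelWithCorners.Boundaryless.range_eq_univ, mfderivWithin_univ] at hcomp
  exact DFunLike.congr_fun hcomp v

theorem chartSymmDeriv_coordComp {x₀ : M} {u : EuclideanSpace ℝ (Fin d)}
    (hu : u ∈ (extChartAt (𝓡 d) x₀).target)
    (X : TangentSpace (𝓡 d) ((extChartAt (𝓡 d) x₀).symm u)) :
    chartSymmDeriv x₀ u (coordComp x₀ X) = X := by
  have hcomp := mfderivWithin_extChartAt_symm_comp_mfderiv_extChartAt (I := 𝓡 d) hu
  rw [ModelWithCorners.Boundaryless.range_eq_univ, mfderivWithin_univ] at hcomp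
  exact DFunLike.congr_fun hcomp X

theorem contMDiffOn_along_chart_iff (x₀ : M)
    {Z : ∀ u, TangentSpace (𝓡 d) ((extChartAt (𝓡 d) x₀).symm u)} :
    ContMDiffOn 𝓘(ℝ, EuclideanSpace ℝ (Fin d)) (𝓡 d).tangent ∞
        (fun u => (⟨(extChartAt (𝓡 d) x₀).symm u, Z u⟩ : TangentBundle (𝓡 d) M))
        (extChartAt (𝓡 d) x₀).target ↔
      ContDiffOn ℝ ∞ (fun u => coordComp x₀ (Z u)) (extChartAt (𝓡 d) x₀).target := by
  have hsource {u} (hu : u ∈ (extChartAt (𝓡 d) x₀).target) :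
      (extChartAt (𝓡 d) x₀).symm u ∈ (chartAt (EuclideanSpace ℝ (Fin d)) x₀).source := by
    rw [← extChartAt_source (𝓡 d)]
    exact (extChartAt (𝓡 d) x₀).map_target hu
  let e := trivializationAt (EuclideanSpace ℝ (Fin d)) (TangentSpace (𝓡 d)) x₀
  have he : Set.MapsTo
      (fun u => (⟨(extChartAt (𝓡 d) x₀).symm u, Z u⟩ : TangentBundle (𝓡 d) M))
      (extChartAt (𝓡 d) x₀).target e.source := fun u hu => by
    rw [e.mem_source]
    exact hsource hu
  rw [Bundle.Trivialization.contMDiffOn_iff he,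
    and_iff_right (contMDiffOn_extChartAt_symm (I := 𝓡 d) (n := ∞) x₀),
    contMDiffOn_iff_contDiffOn]
  refine contDiffOn_congr fun u hu => ?_
  have hmem : (extChartAt (𝓡 d) x₀).symm u ∈ e.baseSet := hsource hu
  rw [← e.continuousLinearMapAt_apply_of_mem (R := ℝ) hmem,
    TangentBundle.continuousLinearMapAt_trivializationAt (hsource hu)]
  rfl

theorem contMDiffOn_coordVec (x₀ : M) (i : Fin d) :
    ContMDiffOn 𝓘(ℝ, EuclideanSpace ℝ (Fin d)) (𝓡 d).tangent ∞
      (fun u => (⟨(extChartAt (𝓡 d) x₀).symm u, coordVec x₀ i u⟩ : TangentBundle (𝓡 d) M))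
      (extChartAt (𝓡 d) x₀).target :=
  (contMDiffOn_along_chart_iff x₀).mpr <|
    contDiffOn_const.congr fun _ hu => coordComp_chartSymmDeriv hu (EuclideanSpace.single i 1)

theorem contDiffOn_metricCoeff (g : SmoothMetric d M) (x₀ : M) :
    ContDiffOn ℝ ∞ (metricCoeff g x₀) (extChartAt (𝓡 d) x₀).target := by
  refine contDiffOn_matrix_of_apply fun i j => ?_
  have hg : ContMDiffOn 𝓘(ℝ, EuclideanSpace ℝ (Fin d)) ((𝓡 d).prod 𝓘(ℝ)) ∞
      (fun u => Bundle.TotalSpace.mk' ℝ (E := Bundle.Trivial M ℝ) ((extChartAt (𝓡 d) x₀).symm u)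
        (metricCoeff g x₀ u i j)) (extChartAt (𝓡 d) x₀).target :=
    ContMDiffOn.clm_bundle_apply₂ (F₁ := EuclideanSpace ℝ (Fin d))
      (F₂ := EuclideanSpace ℝ (Fin d))
      (g.contMDiff.comp_contMDiffOn (contMDiffOn_extChartAt_symm x₀))
      (contMDiffOn_coordVec x₀ i) (contMDiffOn_coordVec x₀ j)
  refine contMDiffOn_iff_contDiffOn.mp fun u hu => ?_
  exact ((Bundle.contMDiffWithinAt_totalSpace).mp (hg u hu)).2

end Charts

section TensorsInChart

open scoped Matrix Matrix.Norms.Operator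

variable {d : ℕ} {M : Type*} [TopologicalSpace M] [ChartedSpace (EuclideanSpace ℝ (Fin d)) M]
  [IsManifold (𝓡 d) ∞ M] {g : SmoothMetric d M} {J : SmoothEndField d M} {x₀ : M}
  {u : EuclideanSpace ℝ (Fin d)}

theorem dotProduct_metricCoeff_mulVec (g : SmoothMetric d M) (x₀ : M)
    (u v w : EuclideanSpace ℝ (Fin d)) :
    v ⬝ᵥ metricCoeff g x₀ u *ᵥ w =
      g.inner ((extChartAt (𝓡 d) x₀).symm u) (chartSymmDeriv x₀ u v) (chartSymmDeriv x₀ u w) := by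
  simp only [chartSymmDeriv_eq_sum, map_sum, map_smul, sum_apply,
    smul_apply, smul_eq_mul, dotProduct, Matrix.mulVec, metricCoeff,
    Matrix.of_apply, Finset.mul_sum]
  rw [Finset.sum_comm]
  exact Finset.sum_congr rfl fun i _ => Finset.sum_congr rfl fun j _ => by ring

theorem metricCoeff_isSymm (g : SmoothMetric d M) (x₀ : M) (u : EuclideanSpace ℝ (Fin d)) :
    (metricCoeff g x₀ u).IsSymm :=
  Matrix.IsSymm.ext fun _ _ => g.symm _ _ _

theorem metricCoeff_posDef (g : SmoothMetric d M) (hu : u ∈ (extChartAt (𝓡 d) x₀).target) :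
    (metricCoeff g x₀ u).PosDef := by
  refine .of_dotProduct_mulVec_pos (metricCoeff_isSymm g x₀ u) fun v hv => ?_
  refine (g.pos _ (chartSymmDeriv x₀ u (WithLp.toLp 2 v)) fun h0 => hv ?_).trans_eq
    (dotProduct_metricCoeff_mulVec g x₀ u (WithLp.toLp 2 v) (WithLp.toLp 2 v)).symm
  have hcomp := coordComp_chartSymmDeriv hu (WithLp.toLp 2 v)
  rw [h0] at hcomp
  rw [← coordCLM_apply, map_zero] at hcomp
  exact (congrArg WithLp.ofLp hcomp).symm

theorem inner_eq_dotProduct (g : SmoothMetric d M) {x : M} (hx : x ∈ (extChartAt (𝓡 d) x₀).source)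
    (X Y : TangentSpace (𝓡 d) x) :
    g.inner x X Y =
      coordComp x₀ X ⬝ᵥ metricCoeff g x₀ (extChartAt (𝓡 d) x₀ x) *ᵥ coordComp x₀ Y := by
  obtain ⟨u, hu, rfl⟩ := (extChartAt (𝓡 d) x₀).symm.surjOn hx
  rw [(extChartAt (𝓡 d) x₀).right_inv hu, dotProduct_metricCoeff_mulVec,
    chartSymmDeriv_coordComp hu, chartSymmDeriv_coordComp hu]

/-- The matrix `J^k_j` of an endomorphism field in the chart at `x₀`, for use with the
matrix-valued connection form. -/
noncomputable def endMatrix (J : SmoothEndField d M) (x₀ : M) (u : EuclideanSpace ℝ (Fin d)) :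
    Matrix (Fin d) (Fin d) ℝ :=
  Matrix.of fun k j => endCoeff J x₀ k j u

theorem contDiffOn_endMatrix (J : SmoothEndField d M) (x₀ : M) :
    ContDiffOn ℝ ∞ (endMatrix J x₀) (extChartAt (𝓡 d) x₀).target := by
  refine contDiffOn_matrix_of_apply fun k j => ?_
  have hJ := (contMDiffOn_along_chart_iff x₀).mp <|
    ContMDiffOn.clm_bundle_apply (F₁ := EuclideanSpace ℝ (Fin d))
      (F₂ := EuclideanSpace ℝ (Fin d))
      (J.contMDiff.comp_contMDiffOn (contMDiffOn_extChartAt_symm x₀)) (contMDiffOn_coordVec x₀ j)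
  exact (EuclideanSpace.proj k : EuclideanSpace ℝ (Fin d) →L[ℝ] ℝ).contDiff.comp_contDiffOn hJ

theorem coordComp_endField_apply (J : SmoothEndField d M) {x : M}
    (hx : x ∈ (extChartAt (𝓡 d) x₀).source) (X : TangentSpace (𝓡 d) x) :
    (coordComp x₀ (J x X)).ofLp = endMatrix J x₀ (extChartAt (𝓡 d) x₀ x) *ᵥ coordComp x₀ X := by
  obtain ⟨u, hu, rfl⟩ := (extChartAt (𝓡 d) x₀).symm.surjOn hx
  rw [(extChartAt (𝓡 d) x₀).right_inv hu]
  conv_lhs => rw [← chartSymmDeriv_coordComp hu X, chartSymmDeriv_eq_sum, ← coordCLM_apply]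
  ext k
  simp only [map_sum, map_smul, WithLp.ofLp_sum, WithLp.ofLp_smul, Finset.sum_apply,
    Pi.smul_apply, smul_eq_mul]
  exact Finset.sum_congr rfl fun _ _ => mul_comm _ _

theorem curvCoeff_eq_connectionCurvature (g : SmoothMetric d M)
    (hu : u ∈ (extChartAt (𝓡 d) x₀).target) (l k i j : Fin d) :
    curvCoeff g x₀ l k i j u =
      connectionCurvature (leviCivitaMatrix (metricCoeff g x₀)) i j u l k := by
  have hΓ (i : Fin d) : DifferentiableAt ℝ (leviCivitaMatrix (metricCoeff g x₀) i) u :=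
    differentiableAt_of_contDiffOn (isOpen_extChartAt_target x₀)
      (contDiffOn_leviCivitaMatrix (isOpen_extChartAt_target x₀) (contDiffOn_metricCoeff g x₀)
        (fun v hv => (metricCoeff_posDef g hv).det_pos.ne') i) hu
  simp only [connectionCurvature, Matrix.add_apply, Matrix.sub_apply, Matrix.mul_apply,
    ← partialDeriv_matrix_apply (hΓ _), ← Finset.sum_sub_distrib]
  rfl

end TensorsInChart

section CurvatureTensor

open scoped Matrix Matrix.Norms.Operator

variable {d : ℕ} {M : Type*} [TopologicalSpace M] [ChartedSpace (EuclideanSpace ℝ (Fin d)) M]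
  [IsManifold (𝓡 d) ∞ M] {g : SmoothMetric d M} {J : SmoothEndField d M} {x₀ p : M}
  {u : EuclideanSpace ℝ (Fin d)}

theorem riemannTensor_eq_sum_dotProduct (g : SmoothMetric d M) {p : M}
    (X Y Z W : TangentSpace (𝓡 d) p) :
    riemannTensor g p X Y Z W = ∑ i, ∑ j, coordComp p X i * coordComp p Y j *
      ((connectionCurvature (leviCivitaMatrix (metricCoeff g p)) i j (extChartAt (𝓡 d) p p)
          *ᵥ coordComp p Z) ⬝ᵥ
        metricCoeff g p (extChartAt (𝓡 d) p p) *ᵥ coordComp p W) := by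
  refine Finset.sum_congr rfl fun i _ => Finset.sum_congr rfl fun j _ => ?_
  simp only [curvCoeff_eq_connectionCurvature g (mem_extChartAt_target p), dotProduct,
    Matrix.mulVec, Finset.sum_mul, Finset.mul_sum]
  rw [Finset.sum_comm]
  refine Finset.sum_congr rfl fun l _ => ?_
  rw [Finset.sum_comm]
  exact Finset.sum_congr rfl fun m _ => Finset.sum_congr rfl fun k _ => by ring

namespace IsKaehler

theorem partialDeriv_endMatrix (hM : IsKaehler g J) (hu : u ∈ (extChartAt (𝓡 d) x₀).target)
    (i : Fin d) :
    partialDeriv i (endMatrix J x₀) u =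
      endMatrix J x₀ u * leviCivitaMatrix (metricCoeff g x₀) i u
        - leviCivitaMatrix (metricCoeff g x₀) i u * endMatrix J x₀ u := by
  ext k j
  have hparallel : partialDeriv i (fun v => endMatrix J x₀ v k j) u
      + ∑ m, (leviCivitaMatrix (metricCoeff g x₀) i u k m * endMatrix J x₀ u m j
        - leviCivitaMatrix (metricCoeff g x₀) i u m j * endMatrix J x₀ u k m) = 0 :=
    hM.parallel x₀ u hu k i j
  rw [partialDeriv_matrix_apply (differentiableAt_of_contDiffOn (isOpen_extChartAt_target x₀)
    (contDiffOn_endMatrix J x₀) hu), Finset.sum_sub_distrib] at hparallel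
  simp only [Matrix.sub_apply, Matrix.mul_apply, mul_comm (endMatrix J x₀ u k _)]
  linarith

theorem commute_connectionCurvature_endMatrix (hM : IsKaehler g J)
    (hu : u ∈ (extChartAt (𝓡 d) x₀).target) (i j : Fin d) :
    Commute (connectionCurvature (leviCivitaMatrix (metricCoeff g x₀)) i j u)
      (endMatrix J x₀ u) := by
  have hO := isOpen_extChartAt_target (I := 𝓡 d) x₀
  exact commute_connectionCurvature_of_parallel hO hu
    (fun i => differentiableAt_of_contDiffOn hO (contDiffOn_leviCivitaMatrix hO
      (contDiffOn_metricCoeff g x₀) (fun v hv => (metricCoeff_posDef g hv).det_pos.ne') i) hu)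
    (contDiffOn_endMatrix J x₀) (fun v hv => hM.partialDeriv_endMatrix hv) i j

theorem dotProduct_endMatrix_mulVec (hM : IsKaehler g J)
    (hu : u ∈ (extChartAt (𝓡 d) x₀).target) (v w : Fin d → ℝ) :
    (endMatrix J x₀ u *ᵥ v) ⬝ᵥ metricCoeff g x₀ u *ᵥ endMatrix J x₀ u *ᵥ w =
      v ⬝ᵥ metricCoeff g x₀ u *ᵥ w := by
  have hx := (extChartAt (𝓡 d) x₀).map_target hu
  have horth := hM.orthogonal _ (chartSymmDeriv x₀ u (WithLp.toLp 2 v))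
    (chartSymmDeriv x₀ u (WithLp.toLp 2 w))
  simpa only [inner_eq_dotProduct g hx, coordComp_endField_apply J hx,
    coordComp_chartSymmDeriv hu, (extChartAt (𝓡 d) x₀).right_inv hu] using horth

theorem riemannTensor_apply_apply (hM : IsKaehler g J) (X Y Z W : TangentSpace (𝓡 d) p) :
    riemannTensor g p X Y (J p Z) (J p W) = riemannTensor g p X Y Z W := by
  have hu := mem_extChartAt_target (I := 𝓡 d) p
  simp only [riemannTensor_eq_sum_dotProduct,
    coordComp_endField_apply J (mem_extChartAt_source (I := 𝓡 d) p),
    Matrix.mulVec_mulVec _ _ (endMatrix J p _),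
    (hM.commute_connectionCurvature_endMatrix hu _ _).eq]
  simp only [← Matrix.mulVec_mulVec, hM.dotProduct_endMatrix_mulVec hu]

theorem inner_self_apply (hM : IsKaehler g J) (X : TangentSpace (𝓡 d) p) :
    g.inner p X (J p X) = 0 := by
  have horth := hM.orthogonal p X (J p X)
  rw [hM.sq_eq_neg, map_neg, g.symm] at horth
  linarith

theorem sectionalCurvature_apply_self (hM : IsKaehler g J) (X : TangentSpace (𝓡 d) p) :
    sectionalCurvature g p X (J p X) =
      riemannTensor g p X (J p X) (J p X) X / g.inner p X X ^ 2 := by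
  rw [sectionalCurvature, hM.orthogonal, hM.inner_self_apply]
  ring

end IsKaehler

end CurvatureTensor

/-! ### Isometric immersions -/

section ImmersionInChart

open scoped Matrix.Norms.Operator

variable {d : ℕ} {M : Type*} [TopologicalSpace M] [ChartedSpace (EuclideanSpace ℝ (Fin d)) M]
  [IsManifold (𝓡 d) ∞ M] {F : Type*} [NormedAddCommGroup F] [NormedSpace ℝ F]
  {g : SmoothMetric d M} {f : M → F} {x₀ p : M} {u : EuclideanSpace ℝ (Fin d)}

/-- The second fundamental form at `p` of a map `f` into a vector space, that is, the covariant
Hessian `(X, Y) ↦ X(Y f) - (∇_X Y) f` of `f`, computed in the chart at `p`. -/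
noncomputable def secondFundamentalForm (g : SmoothMetric d M) (f : M → F) (p : M) :
    TangentSpace (𝓡 d) p →ₗ[ℝ] TangentSpace (𝓡 d) p →ₗ[ℝ] F :=
  LinearMap.mk₂ ℝ
    (fun X Y => ∑ i, ∑ j, (coordComp p X i * coordComp p Y j) •
      secondFundamentalCoeff (leviCivitaMatrix (metricCoeff g p)) (f ∘ (extChartAt (𝓡 d) p).symm)
        i j (extChartAt (𝓡 d) p p))
    (fun X Y Z => by simp [← coordCLM_apply, add_mul, add_smul, Finset.sum_add_distrib])
    (fun c X Y => by simp [← coordCLM_apply, mul_assoc, mul_smul, Finset.smul_sum])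
    (fun X Y Z => by simp [← coordCLM_apply, mul_add, add_smul, Finset.sum_add_distrib])
    (fun c X Y => by simp [← coordCLM_apply, mul_left_comm, mul_smul, Finset.smul_sum])

theorem secondFundamentalForm_apply (g : SmoothMetric d M) (f : M → F)
    (X Y : TangentSpace (𝓡 d) p) :
    secondFundamentalForm g f p X Y = ∑ i, ∑ j, (coordComp p X i * coordComp p Y j) •
      secondFundamentalCoeff (leviCivitaMatrix (metricCoeff g p)) (f ∘ (extChartAt (𝓡 d) p).symm)
        i j (extChartAt (𝓡 d) p p) := rfl

theorem contDiffOn_comp_extChartAt_symm (hf : ContMDiff (𝓡 d) 𝓘(ℝ, F) ∞ f) (x₀ : M) :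
    ContDiffOn ℝ ∞ (f ∘ (extChartAt (𝓡 d) x₀).symm) (extChartAt (𝓡 d) x₀).target :=
  contMDiffOn_iff_contDiffOn.mp (hf.comp_contMDiffOn (contMDiffOn_extChartAt_symm x₀))

theorem partialDeriv_comp_extChartAt_symm (hf : ContMDiff (𝓡 d) 𝓘(ℝ, F) ∞ f)
    (hu : u ∈ (extChartAt (𝓡 d) x₀).target) (i : Fin d) :
    partialDeriv i (f ∘ (extChartAt (𝓡 d) x₀).symm) u =
      mfderiv (𝓡 d) 𝓘(ℝ, F) f ((extChartAt (𝓡 d) x₀).symm u) (coordVec x₀ i u) := by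
  have hsymm := mdifferentiableWithinAt_extChartAt_symm (I := 𝓡 d) hu
  rw [ModelWithCorners.Boundaryless.range_eq_univ, mdifferentiableWithinAt_univ] at hsymm
  have hchain := mfderiv_comp u ((hf _).mdifferentiableAt (by simp)) hsymm
  rw [mfderiv_eq_fderiv] at hchain
  exact DFunLike.congr_fun hchain (EuclideanSpace.single i 1)

theorem mfderiv_eq_sum_partialDeriv (hf : ContMDiff (𝓡 d) 𝓘(ℝ, F) ∞ f) {x : M}
    (hx : x ∈ (extChartAt (𝓡 d) x₀).source) (X : TangentSpace (𝓡 d) x) :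
    mfderiv (𝓡 d) 𝓘(ℝ, F) f x X = ∑ i, coordComp x₀ X i •
      partialDeriv i (f ∘ (extChartAt (𝓡 d) x₀).symm) (extChartAt (𝓡 d) x₀ x) := by
  obtain ⟨u, hu, rfl⟩ := (extChartAt (𝓡 d) x₀).symm.surjOn hx
  rw [(extChartAt (𝓡 d) x₀).right_inv hu]
  simp only [partialDeriv_comp_extChartAt_symm hf hu]
  conv_lhs => rw [← chartSymmDeriv_coordComp hu X, chartSymmDeriv_eq_sum, map_sum]
  exact Finset.sum_congr rfl fun i _ => map_smul _ _ _

theorem secondFundamentalForm_comm (hf : ContMDiff (𝓡 d) 𝓘(ℝ, F) ∞ f)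
    (X Y : TangentSpace (𝓡 d) p) :
    secondFundamentalForm g f p X Y = secondFundamentalForm g f p Y X := by
  have hO := isOpen_extChartAt_target (I := 𝓡 d) p
  have hu := mem_extChartAt_target (I := 𝓡 d) p
  rw [secondFundamentalForm_apply, secondFundamentalForm_apply, Finset.sum_comm]
  refine Finset.sum_congr rfl fun j _ => Finset.sum_congr rfl fun i _ => ?_
  rw [mul_comm, secondFundamentalCoeff_comm hO (contDiffOn_comp_extChartAt_symm hf p) hu
    (leviCivitaMatrix_comm hO hu fun v _ => metricCoeff_isSymm g p v)]

variable {b : LinearMap.BilinForm ℝ F}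

/-- Isometric immersions of `(M, g)` into the pseudo-Euclidean space `(F, b)`: smooth maps that
induce `g` from the bilinear form `b`. -/
structure IsPseudoEuclideanImmersion (g : SmoothMetric d M) (b : LinearMap.BilinForm ℝ F)
    (f : M → F) : Prop where
  smooth : ContMDiff (𝓡 d) 𝓘(ℝ, F) ∞ f
  isometric : ∀ (x : M) (X Y : TangentSpace (𝓡 d) x),
    b (mfderiv (𝓡 d) 𝓘(ℝ, F) f x X : F) (mfderiv (𝓡 d) 𝓘(ℝ, F) f x Y : F) = g.inner x X Y

theorem bilin_secondFundamentalForm (X Y Z W : TangentSpace (𝓡 d) p) :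
    b (secondFundamentalForm g f p X W) (secondFundamentalForm g f p Y Z) =
      ∑ i, ∑ j, ∑ k, ∑ m, coordComp p X i * coordComp p Y j * coordComp p Z k * coordComp p W m *
        b (secondFundamentalCoeff (leviCivitaMatrix (metricCoeff g p))
            (f ∘ (extChartAt (𝓡 d) p).symm) i m (extChartAt (𝓡 d) p p))
          (secondFundamentalCoeff (leviCivitaMatrix (metricCoeff g p))
            (f ∘ (extChartAt (𝓡 d) p).symm) j k (extChartAt (𝓡 d) p p)) := by
  simp only [secondFundamentalForm_apply, map_sum, map_smul, LinearMap.sum_apply,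
    LinearMap.smul_apply, smul_eq_mul, Finset.mul_sum]
  conv_rhs => rw [Finset.sum_comm]
  refine Finset.sum_congr rfl fun j _ => ?_
  rw [Finset.sum_comm]
  refine Finset.sum_congr rfl fun i _ => ?_
  refine Finset.sum_congr rfl fun k _ => Finset.sum_congr rfl fun m _ => ?_
  ring

namespace IsPseudoEuclideanImmersion

theorem metricCoeff_eq_bilin (hf : IsPseudoEuclideanImmersion g b f)
    (hu : u ∈ (extChartAt (𝓡 d) x₀).target) (i j : Fin d) :
    metricCoeff g x₀ u i j = b (partialDeriv i (f ∘ (extChartAt (𝓡 d) x₀).symm) u)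
      (partialDeriv j (f ∘ (extChartAt (𝓡 d) x₀).symm) u) := by
  rw [partialDeriv_comp_extChartAt_symm hf.smooth hu,
    partialDeriv_comp_extChartAt_symm hf.smooth hu]
  exact (hf.isometric _ _ _).symm

variable [FiniteDimensional ℝ F]

theorem secondFundamentalCoeff_normal (hf : IsPseudoEuclideanImmersion g b f) (hb : b.IsSymm)
    (hu : u ∈ (extChartAt (𝓡 d) x₀).target) (i j m : Fin d) :
    b (secondFundamentalCoeff (leviCivitaMatrix (metricCoeff g x₀))
        (f ∘ (extChartAt (𝓡 d) x₀).symm) i j u)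
      (partialDeriv m (f ∘ (extChartAt (𝓡 d) x₀).symm) u) = 0 :=
  secondFundamentalCoeff_leviCivitaMatrix_normal (isOpen_extChartAt_target x₀)
    (contDiffOn_comp_extChartAt_symm hf.smooth x₀) hb (fun _ hv => hf.metricCoeff_eq_bilin hv) hu
    (metricCoeff_posDef g hu).det_pos.ne' i j m

theorem secondFundamentalForm_normal (hf : IsPseudoEuclideanImmersion g b f) (hb : b.IsSymm)
    (X Y Z : TangentSpace (𝓡 d) p) :
    b (secondFundamentalForm g f p X Y) (mfderiv (𝓡 d) 𝓘(ℝ, F) f p Z : F) = 0 := by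
  rw [mfderiv_eq_sum_partialDeriv hf.smooth (mem_extChartAt_source (I := 𝓡 d) p),
    secondFundamentalForm_apply]
  simp only [map_sum, map_smul, LinearMap.sum_apply, LinearMap.smul_apply, smul_zero,
    hf.secondFundamentalCoeff_normal hb (mem_extChartAt_target p), Finset.sum_const_zero]

theorem riemannTensor_eq_gaussTensor (hf : IsPseudoEuclideanImmersion g b f) (hb : b.IsSymm)
    (X Y Z W : TangentSpace (𝓡 d) p) :
    riemannTensor g p X Y Z W = gaussTensor b (secondFundamentalForm g f p) X Y Z W := by
  have hO := isOpen_extChartAt_target (I := 𝓡 d) p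
  have hu := mem_extChartAt_target (I := 𝓡 d) p
  have hgauss := gauss_equation hO (contDiffOn_comp_extChartAt_symm hf.smooth p)
    (contDiffOn_leviCivitaMatrix hO (contDiffOn_metricCoeff g p)
      fun v hv => (metricCoeff_posDef g hv).det_pos.ne') hb
    (fun v hv => hf.secondFundamentalCoeff_normal hb hv) hu
  have hcoeff (i j k m : Fin d) : ∑ l, metricCoeff g p (extChartAt (𝓡 d) p p) l m *
      curvCoeff g p l k i j (extChartAt (𝓡 d) p p) = _ :=
    Eq.trans (Finset.sum_congr rfl fun l _ => by
      rw [hf.metricCoeff_eq_bilin hu, curvCoeff_eq_connectionCurvature g hu, mul_comm])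
      (hgauss i j k m)
  rw [gaussTensor, bilin_secondFundamentalForm X Y Z W, bilin_secondFundamentalForm X Y W Z,
    ← Finset.sum_sub_distrib]
  refine Finset.sum_congr rfl fun i _ => ?_
  rw [← Finset.sum_sub_distrib]
  refine Finset.sum_congr rfl fun j _ => ?_
  rw [Finset.sum_comm (γ := Fin d) (f := fun (k m : Fin d) => _ * coordComp p W k * _ * _),
    ← Finset.sum_sub_distrib]
  refine Finset.sum_congr rfl fun k _ => ?_
  rw [Finset.sum_comm, ← Finset.sum_sub_distrib]
  refine Finset.sum_congr rfl fun m _ => ?_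
  simp only [← Finset.sum_mul, hcoeff]
  ring

end IsPseudoEuclideanImmersion

theorem bilin_self_mfderiv [FiniteDimensional ℝ F] {c : ℝ} (hf : ContMDiff (𝓡 d) 𝓘(ℝ, F) ∞ f)
    (hb : b.IsSymm) (hc : ∀ x, b (f x) (f x) = c) (X : TangentSpace (𝓡 d) p) :
    b (f p) (mfderiv (𝓡 d) 𝓘(ℝ, F) f p X : F) = 0 := by
  have hself (i : Fin d) := bilin_self_partialDeriv (isOpen_extChartAt_target p)
    (contDiffOn_comp_extChartAt_symm hf p) hb (fun v _ => hc _) (mem_extChartAt_target p) i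
  simp only [Function.comp_apply, extChartAt_to_inv] at hself
  rw [mfderiv_eq_sum_partialDeriv hf (mem_extChartAt_source (I := 𝓡 d) p)]
  simp only [map_sum, map_smul, hself, smul_zero, Finset.sum_const_zero]

theorem bilin_self_secondFundamentalForm [FiniteDimensional ℝ F] {c : ℝ}
    (hf : ContMDiff (𝓡 d) 𝓘(ℝ, F) ∞ f) (hb : b.IsSymm) (hc : ∀ x, b (f x) (f x) = c)
    (X Y : TangentSpace (𝓡 d) p) :
    b (f p) (secondFundamentalForm g f p X Y) =
      -b (mfderiv (𝓡 d) 𝓘(ℝ, F) f p X : F) (mfderiv (𝓡 d) 𝓘(ℝ, F) f p Y : F) := by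
  have hself (i j : Fin d) := bilin_self_secondFundamentalCoeff
    (A := leviCivitaMatrix (metricCoeff g p)) (isOpen_extChartAt_target p)
    (contDiffOn_comp_extChartAt_symm hf p) hb (fun v _ => hc _) (mem_extChartAt_target p) i j
  simp only [Function.comp_apply, extChartAt_to_inv] at hself
  rw [mfderiv_eq_sum_partialDeriv hf (mem_extChartAt_source (I := 𝓡 d) p),
    mfderiv_eq_sum_partialDeriv hf (mem_extChartAt_source (I := 𝓡 d) p),
    secondFundamentalForm_apply]
  simp only [map_sum, map_smul, LinearMap.sum_apply, LinearMap.smul_apply, smul_eq_mul, hself,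
    mul_neg, Finset.sum_neg_distrib, Finset.mul_sum]
  rw [Finset.sum_comm]
  simp only [mul_assoc, mul_left_comm (coordComp p X _)]

end ImmersionInChart

section AlmostComplex

open Module

variable {V : Type*} [AddCommGroup V] [Module ℝ V]

/-- The complex vector space structure on a real vector space in which `i` acts as a given
endomorphism `J` with `J ^ 2 = -1`. -/
abbrev complexModule (J : End ℝ V) (hJ : J * J = -1) : Module ℂ V :=
  Module.compHom V (Complex.lift ⟨J, hJ⟩ : ℂ →ₐ[ℝ] End ℝ V).toRingHom

theorem complexModule_I_smul (J : End ℝ V) (hJ : J * J = -1) (X : V) :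
    letI := complexModule J hJ
    Complex.I • X = J X := by
  change (Complex.lift ⟨J, hJ⟩ : ℂ →ₐ[ℝ] End ℝ V) Complex.I X = J X
  rw [Complex.lift_apply, Complex.liftAux_apply_I]

theorem complexModule_isScalarTower (J : End ℝ V) (hJ : J * J = -1) :
    letI := complexModule J hJ
    IsScalarTower ℝ ℂ V :=
  letI := complexModule J hJ
  ⟨fun r c X => DFunLike.congr_fun
    (map_smul (Complex.lift ⟨J, hJ⟩ : ℂ →ₐ[ℝ] End ℝ V) r c) X⟩

end AlmostComplex

section HyperbolicImmersion

variable {d m : ℕ} {M : Type*} [TopologicalSpace M] [ChartedSpace (EuclideanSpace ℝ (Fin d)) M]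
  [IsManifold (𝓡 d) ∞ M] {g : SmoothMetric d M} {f : M → HyperbolicSpace m}

namespace IsIsometricImmersion

theorem isPseudoEuclideanImmersion (hf : IsIsometricImmersion g f) :
    IsPseudoEuclideanImmersion g (lorentzForm m) (fun x => (f x : LorentzSpace m)) :=
  ⟨hf.smooth, hf.isometric⟩

theorem isHyperbolicTwoJet (hf : IsIsometricImmersion g f) (p : M) :
    IsHyperbolicTwoJet (f p : LorentzSpace m)
      (V := TangentSpace (𝓡 d) p)
      (mfderiv (𝓡 d) 𝓘(ℝ, LorentzSpace m) (fun x => (f x : LorentzSpace m)) p).toLinearMap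
      (secondFundamentalForm g (fun x => (f x : LorentzSpace m)) p) where
  position_self := (f p).2.1.trans_lt neg_one_lt_zero
  position_tangent := bilin_self_mfderiv hf.smooth (lorentzForm_isSymm m) fun x => (f x).2.1
  tangent_pos X hX := (g.pos p X hX).trans_eq (hf.isometric p X X).symm
  comm := secondFundamentalForm_comm hf.smooth
  normal := hf.isPseudoEuclideanImmersion.secondFundamentalForm_normal (lorentzForm_isSymm m)
  position_apply := bilin_self_secondFundamentalForm hf.smooth (lorentzForm_isSymm m)
    fun x => (f x).2.1

end IsIsometricImmersion

end HyperbolicImmersion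

theorem mainTheorem3_general {d m : ℕ} (hdim : 2 * (m + 1) ≤ 3 * d) {M : Type*}
    [TopologicalSpace M] [ChartedSpace (EuclideanSpace ℝ (Fin d)) M] [IsManifold (𝓡 d) ∞ M]
    {g : SmoothMetric d M} {J : SmoothEndField d M} (hM : IsKaehler g J)
    {f : M → HyperbolicSpace m} (hf : IsIsometricImmersion g f) (p : M) :
    ∃ X : TangentSpace (𝓡 d) p, X ≠ 0 ∧ sectionalCurvature g p X (J p X) ≤ 0 := by
  have hJ : (J p).toLinearMap * (J p).toLinearMap = -1 := LinearMap.ext (hM.sq_eq_neg p)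
  let := complexModule (J p).toLinearMap hJ
  have := complexModule_isScalarTower (J p).toLinearMap hJ
  have hI (X : TangentSpace (𝓡 d) p) : Complex.I • X = J p X :=
    complexModule_I_smul (J p).toLinearMap hJ X
  have hfinrank : Module.finrank ℝ (TangentSpace (𝓡 d) p) = d := finrank_euclideanSpace_fin
  have hfinrank_complex := Module.finrank_mul_finrank ℝ ℂ (TangentSpace (𝓡 d) p)
  rw [Complex.finrank_real_complex] at hfinrank_complex
  have hgauss := hf.isPseudoEuclideanImmersion.riemannTensor_eq_gaussTensor (p := p)
    (lorentzForm_isSymm m)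
  obtain ⟨X, hX, hnonpos⟩ := (hf.isHyperbolicTwoJet p).exists_gaussTensor_nonpos (by omega)
    (fun X Y => by
      rw [hI, hI]
      exact ((hf.isometric p _ _).trans (hM.orthogonal p X Y)).trans (hf.isometric p X Y).symm)
    (fun X Y Z W => by rw [← hgauss, ← hgauss, hI, hI, hM.riemannTensor_apply_apply])
  refine ⟨X, hX, ?_⟩
  rw [hI, ← hgauss] at hnonpos
  rw [hM.sectionalCurvature_apply_self]
  exact div_nonpos_of_nonpos_of_nonneg hnonpos (sq_nonneg _)

theorem mainTheorem3 (n : ℕ) (hn : 2 ≤ n) {M : Type*} [TopologicalSpace M]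
    [ChartedSpace (EuclideanSpace ℝ (Fin (2 * n))) M] [IsManifold (𝓡 (2 * n)) ∞ M]
    (g : SmoothMetric (2 * n) M) (J : SmoothEndField (2 * n) M) (hM : IsKaehler g J)
    (hpos : ∃ p : M, HasPosHolSecCurvAt g J p) :
    ¬ ∃ f : M → HyperbolicSpace (3 * n - 1), IsIsometricImmersion g f := by
  rintro ⟨f, hf⟩
  obtain ⟨p, hp⟩ := hpos
  obtain ⟨X, hX, hnonpos⟩ := mainTheorem3_general (by omega) hM hf p
  exact (hp X hX).not_ge hnonpos
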